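/- Let $M$ be a smooth (Hausdorff, $\sigma$-compact) $n$-dimensional manifold, let $\Lambda^{\star}=\bigoplus_a\Lambda^{\star a}$ be the exterior algebra of its multivector fields over $C^\infty(M)$, let $\eta$ be a volume element on $M$ (so $M$ is oriented by $\eta$), $\varepsilon=\pm1$, and let $\eta^\star\in\Lambda^{\star n}$ be the dual $n$-vector field, normalised by $\eta(\eta^\star)=\varepsilon$. For a multivector field $A$ and a form $\gamma$ let $(\gamma,A)$ denote the interior product that fills the last slots of $\gamma$ with $A$ (a form, when $\deg A\le\deg\gamma$) and let $(A,\gamma)$ denote the one that fills the last slots of $A$ with $\gamma$ (a multivector field, when $\deg\gamma\le\deg A$). Put $\ast A=(\eta,A)$ for multivector fields and $\ast\alpha=(\eta^\star,\alpha)$ for forms, and let $\delta A=\varepsilon(-1)^{na}\ast d\ast A$ for $A\in\Lambda^{\star a}$ be the codifferential. Let $$\{A,B\}_\delta=A\wedge\delta B+(-1)^{a}\bigl(\delta A\wedge B-\delta(A\wedge B)\bigr),\qquad A\in\Lambda^{\star a},\ B\in\Lambda^{\star},$$ extended bilinearly (the Leibniz--Schouten bracket). Then $(\Lambda^{\star},\{\,,\}_\delta)$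 is a $(-1)$-graded Lie algebra: the bracket is $\mathbb R$-bilinear and, for $A,B,C$ homogeneous of degrees $a,b,c$, $\{\Lambda^{\star a},\Lambda^{\star b}\}_\delta\subseteq\Lambda^{\star\,a+b-1}$ and $$\{A,B\}_\delta=-(-1)^{(a-1)(b-1)}\{B,A\}_\delta,\qquad \oint(-1)^{(a-1)(c-1)}\{\{A,B\}_\delta,C\}_\delta=0 ,$$ where $\oint$ is the sum over the cyclic permutations of $(A,a),(B,b),(C,c)$. Equivalently, let $\{\,,\}$ be the Schouten bracket, i.e. the $\mathbb R$-bilinear bracket on $\Lambda^\star$ such that, for $A\in\Lambda^{\star a}$ and $B\in\Lambda^{\star b}$, $\{A,B\}\in\Lambda^{\star\,a+b-1}$ and $$i(\{A,B\})\gamma=(d(\gamma,B),A)+(-1)^{ab}(d(\gamma,A),B)$$ for all closed $(a+b-1)$-forms $\gamma$ (the first term being absent if $a=0$, the second if $b=0$). This bracket exists and is unique, $\{A,B\}=(-1)^a\{A,B\}_\delta$ for $A\in\Lambda^{\star a}$, and $$\{A,B\}=(-1)^{ab}\{B,A\},\qquad \oint(-1)^{ac}\{\{A,B\},C\}=0 .$$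 -/

import Mathlib

open scoped Manifold ContDiff TensorProduct ExteriorAlgebra

noncomputable section

/-! Throughout, `χ` is a commutative `ℝ`-algebra, to be thought of as the ring of smooth functions
on a manifold. -/

/-- Vector fields, as derivations of the ring of functions. -/
abbrev VField (χ : Type*) [CommRing χ] [Algebra ℝ χ] : Type _ :=
  Derivation ℝ χ χ

/-- The exterior contravariant algebra: multivector fields with the exterior product
(written `*`) over the function ring. The fields of degree `a` are `⋀[χ]^a (VField χ)`. -/
abbrev Multivector (χ : Type*) [CommRing χ] [Algebra ℝ χ] : Type _ :=
  ExteriorAlgebra χ (VField χ)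

/-- Differential `k`-forms, as alternating function-multilinear maps on vector fields. -/
abbrev DForm (χ : Type*) [CommRing χ] [Algebra ℝ χ] (k : ℕ) : Type _ :=
  VField χ [⋀^Fin k]→ₗ[χ] χ

section Exterior

variable {χ : Type*} [CommRing χ] [Algebra ℝ χ]

/-- The value of the exterior derivative of a form on vector fields, by the invariant formula
`dα(X₀,…,X_k) = ∑ᵢ (-1)ⁱ Xᵢ(α(…,X̂ᵢ,…)) + ∑_{i<j} (-1)^(i+j) α([Xᵢ,Xⱼ],…,X̂ᵢ,…,X̂ⱼ,…)`.
In the double sum the pair `(i, j)` of the formula is written `(i.castSucc, j.succ)` with `i ≤ j`,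
which accounts for the minus sign. -/
def koszulFormula : ∀ {k : ℕ}, DForm χ k → (Fin (k + 1) → VField χ) → χ
  | 0, α, X => X 0 (α ![])
  | k + 1, α, X =>
    (∑ i : Fin (k + 2), (-1) ^ (i : ℕ) * X i (α (i.removeNth X))) -
      ∑ i : Fin (k + 1), ∑ j ∈ Finset.Ici i, (-1) ^ ((i : ℕ) + (j : ℕ)) *
        α (Matrix.vecCons ⁅X i.castSucc, X j.succ⁆ (j.removeNth (i.castSucc.removeNth X)))

/-- A form, regarded as a real alternating map. -/
def DForm.toReal {k : ℕ} (α : DForm χ k) : VField χ [⋀^Fin k]→ₗ[ℝ] χ :=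
  { α.toMultilinearMap.restrictScalars ℝ with
    map_eq_zero_of_eq' := fun v _ _ h hij => α.map_eq_zero_of_eq v h hij }

@[simp]
theorem DForm.toReal_apply {k : ℕ} (α : DForm χ k) (v : Fin k → VField χ) :
    α.toReal v = α v := rfl

/-- The first sum of the invariant formula. -/
def koszulAux₁ {k : ℕ} (α : DForm χ k) : VField χ →ₗ[ℝ] VField χ [⋀^Fin k]→ₗ[ℝ] χ where
  toFun X := (X : χ →ₗ[ℝ] χ).compAlternatingMap α.toReal
  map_add' X Y := by ext; simp
  map_smul' c X := by ext; simp

/-- The second sum of the invariant formula. -/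
def koszulAux₂ {k : ℕ} (α : DForm χ (k + 1)) :
    VField χ →ₗ[ℝ] VField χ →ₗ[ℝ] VField χ [⋀^Fin k]→ₗ[ℝ] χ :=
  LinearMap.mk₂ ℝ (fun X Y => α.toReal.curryLeft ⁅X, Y⁆)
    (by intros; simp) (by intros; simp) (by intros; simp) (by intros; simp)

/-- The invariant formula as a real alternating map. -/
def koszulAux : ∀ {k : ℕ}, DForm χ k → VField χ [⋀^Fin (k + 1)]→ₗ[ℝ] χ
  | 0, α => AlternatingMap.alternatizeUncurryFin (koszulAux₁ α)
  | _ + 1, α => AlternatingMap.alternatizeUncurryFin (koszulAux₁ α) -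
      (1 / 2 : ℝ) • AlternatingMap.alternatizeUncurryFin
        (AlternatingMap.alternatizeUncurryFinLM ∘ₗ koszulAux₂ α)

theorem koszulAux_apply {k : ℕ} (α : DForm χ k) (X : Fin (k + 1) → VField χ) :
    koszulAux α X = koszulFormula α X := by
  cases k with
  | zero =>
    simp [koszulAux, koszulFormula, AlternatingMap.alternatizeUncurryFin_apply, koszulAux₁]
    congr 2
    exact Subsingleton.elim _ _
  | succ k =>
    have h2 : (AlternatingMap.alternatizeUncurryFin
        (AlternatingMap.alternatizeUncurryFinLM ∘ₗ koszulAux₂ α)) X =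
        (2 : ℝ) • ∑ i : Fin (k + 1), ∑ j ∈ Finset.Ici i, (-1) ^ ((i : ℕ) + (j : ℕ)) *
        α (Matrix.vecCons ⁅X i.castSucc, X j.succ⁆ (j.removeNth (i.castSucc.removeNth X))) := by
      simp only [AlternatingMap.alternatizeUncurryFin_apply, LinearMap.comp_apply,
        AlternatingMap.alternatizeUncurryFinLM_apply, Finset.smul_sum]
      rw [Fin.sum_sum_eq_sum_triangle_add]
      refine Finset.sum_congr rfl fun i _ => Finset.sum_congr rfl fun j hj => ?_
      rw [Finset.mem_Ici] at hj
      rw [Fin.removeNth_removeNth_eq_swap]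
      have H₁ : i.castSucc.succAbove j = j.succ := by simp [Fin.succAbove_of_le_castSucc, hj]
      have H₂ : j.predAbove i.castSucc = i := by simp [Fin.predAbove_of_le_castSucc, hj]
      have H₃ : j.succ.succAbove i = i.castSucc := by simp [Fin.succAbove_of_castSucc_lt, hj]
      have H₄ : (koszulAux₂ α) (X j.succ) (X i.castSucc) =
          -(koszulAux₂ α) (X i.castSucc) (X j.succ) := by
        simp only [koszulAux₂, LinearMap.mk₂_apply]
        rw [← lie_skew, map_neg]
      simp only [H₁, H₂, Fin.removeNth, H₃, H₄]
      simp [koszulAux₂, pow_add, two_smul]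
      ring
    rw [koszulAux, koszulFormula, AlternatingMap.sub_apply, AlternatingMap.smul_apply, h2, smul_smul,
      show (1 / 2 * 2 : ℝ) = 1 by norm_num, one_smul]
    simp [AlternatingMap.alternatizeUncurryFin_apply, koszulAux₁]

theorem removeNth_succ_vecCons {V : Type*} {k : ℕ} (i : Fin (k + 1)) (a : V)
    (X : Fin (k + 1) → V) :
    i.succ.removeNth (Matrix.vecCons a X) = Matrix.vecCons a (i.removeNth X) := by
  funext j
  refine Fin.cases ?_ (fun j => ?_) j <;> simp [Fin.removeNth]

theorem DForm.apply_vecCons_smul {k : ℕ} (α : DForm χ (k + 1)) (f : χ) (Y : VField χ)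
    (W : Fin k → VField χ) :
    α (Matrix.vecCons (f • Y) W) = f * α (Matrix.vecCons Y W) := by
  exact congrArg (fun β => β W) (α.curryLeft.map_smul f Y)

theorem DForm.apply_vecCons_vecCons_smul {k : ℕ} (α : DForm χ (k + 2)) (f : χ) (Z Y : VField χ)
    (W : Fin k → VField χ) :
    α (Matrix.vecCons Z (Matrix.vecCons (f • Y) W)) =
      f * α (Matrix.vecCons Z (Matrix.vecCons Y W)) := by
  exact DForm.apply_vecCons_smul (α.curryLeft Z) f Y W

theorem DForm.apply_vecCons_lie_smul {k : ℕ} (α : DForm χ (k + 1)) (f : χ) (Y Z : VField χ)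
    (W : Fin k → VField χ) :
    α (Matrix.vecCons ⁅f • Y, Z⁆ W) =
      f * α (Matrix.vecCons ⁅Y, Z⁆ W) - Z f * α (Matrix.vecCons Y W) := by
  have h : ⁅f • Y, Z⁆ = f • ⁅Y, Z⁆ - Z f • Y := by
    ext g
    simp [Derivation.commutator_apply]
    ring
  rw [h, ← DForm.apply_vecCons_smul, ← DForm.apply_vecCons_smul]
  exact congrArg (fun β => β W) (α.curryLeft.map_sub (f • ⁅Y, Z⁆) (Z f • Y))

theorem koszulFormula_vecCons {k : ℕ} (α : DForm χ (k + 1)) (Z : VField χ)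
    (X : Fin (k + 1) → VField χ) :
    koszulFormula α (Matrix.vecCons Z X) =
      (Z (α X) + ∑ i : Fin (k + 1), (-1) ^ (i.succ : ℕ) * (Matrix.vecCons Z X i.succ)
          (α (i.succ.removeNth (Matrix.vecCons Z X)))) -
      ((∑ j : Fin (k + 1), (-1) ^ (((0 : Fin (k + 1)) : ℕ) + (j : ℕ)) *
        α (Matrix.vecCons ⁅Matrix.vecCons Z X (Fin.castSucc 0), Matrix.vecCons Z X j.succ⁆
          (j.removeNth ((Fin.castSucc 0).removeNth (Matrix.vecCons Z X))))) +
      ∑ i : Fin k, ∑ j ∈ Finset.Ici i.succ, (-1) ^ ((i.succ : ℕ) + (j : ℕ)) *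
          α (Matrix.vecCons ⁅Matrix.vecCons Z X i.succ.castSucc, Matrix.vecCons Z X j.succ⁆
          (j.removeNth (i.succ.castSucc.removeNth (Matrix.vecCons Z X))))) := by
  simp only [koszulFormula]
  refine congrArg₂ (· - ·) ?_ ?_
  · rw [Fin.sum_univ_succ]
    simp
  · rw [Fin.sum_univ_succ]
    refine congrArg₂ (· + ·) ?_ rfl
    exact Finset.sum_congr (by ext; simp) fun _ _ => rfl

theorem koszulAux_cons_smul {k : ℕ} (α : DForm χ k) (f : χ) (Y : VField χ)
    (X : Fin k → VField χ) :
    koszulAux α (Matrix.vecCons (f • Y) X) = f * koszulAux α (Matrix.vecCons Y X) := by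
  rw [koszulAux_apply, koszulAux_apply]
  cases k with
  | zero => simp [koszulFormula]
  | succ k =>
    rw [koszulFormula_vecCons, koszulFormula_vecCons]
    have hB : ∀ i : Fin k, ∀ j ∈ Finset.Ici i.succ,
        α (Matrix.vecCons ⁅Matrix.vecCons (f • Y) X i.succ.castSucc,
            Matrix.vecCons (f • Y) X j.succ⁆
          (j.removeNth (i.succ.castSucc.removeNth (Matrix.vecCons (f • Y) X)))) =
        f * α (Matrix.vecCons ⁅Matrix.vecCons Y X i.succ.castSucc, Matrix.vecCons Y X j.succ⁆
          (j.removeNth (i.succ.castSucc.removeNth (Matrix.vecCons Y X)))) := by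
      intro i j hj
      cases k with
      | zero => exact i.elim0
      | succ k =>
        obtain ⟨j, rfl⟩ : ∃ j' : Fin (k + 1), j = j'.succ := by
          have hj0 : j ≠ 0 := by
            rintro rfl
            exact absurd (Finset.mem_Ici.mp hj) (not_le.mpr (Fin.succ_pos i))
          exact ⟨j.pred hj0, by simp⟩
        rw [← Fin.succ_castSucc, removeNth_succ_vecCons, removeNth_succ_vecCons,
          removeNth_succ_vecCons, removeNth_succ_vecCons, DForm.apply_vecCons_vecCons_smul]
        simp
    have hB' : ∀ i : Fin k, (∑ j ∈ Finset.Ici i.succ, (-1) ^ ((i.succ : ℕ) + (j : ℕ)) *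
        α (Matrix.vecCons ⁅Matrix.vecCons (f • Y) X i.succ.castSucc,
            Matrix.vecCons (f • Y) X j.succ⁆
          (j.removeNth (i.succ.castSucc.removeNth (Matrix.vecCons (f • Y) X))))) =
        f * ∑ j ∈ Finset.Ici i.succ, (-1) ^ ((i.succ : ℕ) + (j : ℕ)) *
          α (Matrix.vecCons ⁅Matrix.vecCons Y X i.succ.castSucc, Matrix.vecCons Y X j.succ⁆
          (j.removeNth (i.succ.castSucc.removeNth (Matrix.vecCons Y X)))) := by
      intro i
      rw [Finset.mul_sum]
      refine Finset.sum_congr rfl fun j hj => ?_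
      rw [hB i j hj]
      ring
    rw [Finset.sum_congr rfl fun i _ => hB' i, ← Finset.mul_sum]
    have hA : ∀ i : Fin (k + 1), (-1 : χ) ^ (i.succ : ℕ) * (Matrix.vecCons (f • Y) X i.succ)
          (α (i.succ.removeNth (Matrix.vecCons (f • Y) X))) =
        f * ((-1) ^ (i.succ : ℕ) * (Matrix.vecCons Y X i.succ)
          (α (i.succ.removeNth (Matrix.vecCons Y X)))) -
        (-1) ^ (i : ℕ) * (X i f * α (Matrix.vecCons Y (i.removeNth X))) := by
      intro i
      rw [removeNth_succ_vecCons, removeNth_succ_vecCons, DForm.apply_vecCons_smul]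
      simp [pow_succ]
      ring
    have hC : ∀ j : Fin (k + 1), (-1 : χ) ^ (((0 : Fin (k + 1)) : ℕ) + (j : ℕ)) *
        α (Matrix.vecCons ⁅Matrix.vecCons (f • Y) X (Fin.castSucc 0),
            Matrix.vecCons (f • Y) X j.succ⁆
          (j.removeNth ((Fin.castSucc 0).removeNth (Matrix.vecCons (f • Y) X)))) =
        f * ((-1 : χ) ^ (((0 : Fin (k + 1)) : ℕ) + (j : ℕ)) *
        α (Matrix.vecCons ⁅Matrix.vecCons Y X (Fin.castSucc 0), Matrix.vecCons Y X j.succ⁆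
          (j.removeNth ((Fin.castSucc 0).removeNth (Matrix.vecCons Y X))))) -
        (-1) ^ (j : ℕ) * (X j f * α (Matrix.vecCons Y (j.removeNth X))) := by
      intro j
      simp [DForm.apply_vecCons_lie_smul]
      ring
    rw [Finset.sum_congr rfl fun i _ => hA i, Finset.sum_congr rfl fun j _ => hC j,
      Finset.sum_sub_distrib, Finset.sum_sub_distrib, ← Finset.mul_sum, ← Finset.mul_sum]
    simp
    ring

theorem koszulAux_smul {k : ℕ} (α : DForm χ k) (X : Fin (k + 1) → VField χ) (p : Fin (k + 1))
    (f : χ) (Y : VField χ) :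
    koszulAux α (Function.update X p (f • Y)) = f * koszulAux α (Function.update X p Y) := by
  rw [← Fin.insertNth_removeNth, ← Fin.insertNth_removeNth, AlternatingMap.map_insertNth,
    AlternatingMap.map_insertNth]
  rw [koszulAux_cons_smul, mul_smul_comm]

/-- The exterior derivative `d`. -/
def extD {k : ℕ} : DForm χ k →ₗ[ℝ] DForm χ (k + 1) where
  toFun α :=
    { toFun := koszulFormula α
      map_update_add' := fun {inst} X p Y Z => by
        cases Subsingleton.elim inst (instDecidableEqFin _)
        simp only [← koszulAux_apply, AlternatingMap.map_update_add]
      map_update_smul' := fun {inst} X p f Y => by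
        cases Subsingleton.elim inst (instDecidableEqFin _)
        simp only [← koszulAux_apply, koszulAux_smul, smul_eq_mul]
      map_eq_zero_of_eq' := fun X i j h hij => by
        rw [← koszulAux_apply]
        exact (koszulAux α).map_eq_zero_of_eq X h hij }
  map_add' α β := by
    ext X
    cases k <;> simp [koszulFormula, Finset.sum_add_distrib, mul_add]
    ring
  map_smul' c α := by
    ext X
    cases k <;> simp [koszulFormula, Finset.smul_sum, smul_sub]

/-- The value of a `k`-form on a multivector field, `α(X₁ ∧ ⋯ ∧ X_k) = α(X₁, …, X_k)`;
it vanishes on fields of degree other than `k`. -/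
def DForm.eval {k : ℕ} (α : DForm χ k) : Multivector χ →ₗ[χ] χ :=
  ExteriorAlgebra.liftAlternating (Pi.single k α)

/-- `(γ, A)`: the interior product filling the last slots of the form `γ` with `A`,
`(γ, A)(Y₁, …, Y_j) = γ(Y₁ ∧ ⋯ ∧ Y_j ∧ A)`. For `A` of degree `a` and `γ` of degree `c ≥ a` it is
`(-1)^(a(c-a)) i(A)γ` when `j = c - a`, and it vanishes for every other `j`. -/
def DForm.inner {c : ℕ} (γ : DForm χ c) (j : ℕ) : Multivector χ →ₗ[χ] DForm χ j where
  toFun A := (γ.eval ∘ₗ LinearMap.mulRight χ A).compAlternatingMap (ExteriorAlgebra.ιMulti χ j)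
  map_add' A B := by ext; simp [mul_add]
  map_smul' f A := by ext; simp

/-- The grading of the exterior contravariant algebra over the function ring. -/
abbrev wedgeDeg (χ : Type*) [CommRing χ] [Algebra ℝ χ] (a : ℕ) : Submodule χ (Multivector χ) :=
  ⋀[χ]^a (VField χ)

theorem ι_mem_wedgeDeg_one (X : VField χ) : ExteriorAlgebra.ι χ X ∈ wedgeDeg χ 1 := by
  simp [wedgeDeg, ExteriorAlgebra.exteriorPower]

/-- The shuffle coproduct: the algebra map to the graded tensor square with
`X ↦ X ⊗ 1 + 1 ⊗ X` for vector fields `X`. Thus `X₁ ∧ ⋯ ∧ X_m` is sent to the sum of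
`sgn(Sᶜ, S) X_{Sᶜ} ⊗ X_S` over the subsets `S` of `{1, …, m}`. -/
def coproduct : Multivector χ →ₐ[χ] (wedgeDeg χ ᵍ⊗[χ] wedgeDeg χ) :=
  ExteriorAlgebra.lift χ
    ⟨(GradedTensorProduct.includeLeft (wedgeDeg χ) (wedgeDeg χ)).toLinearMap ∘ₗ
        ExteriorAlgebra.ι χ +
      (GradedTensorProduct.includeRight (wedgeDeg χ) (wedgeDeg χ)).toLinearMap ∘ₗ
        ExteriorAlgebra.ι χ, by
      intro X
      have h₁ := GradedTensorProduct.tmul_coe_mul_coe_tmul (R := χ) (wedgeDeg χ) (wedgeDeg χ)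
        1 ⟨_, ι_mem_wedgeDeg_one X⟩ ⟨_, ι_mem_wedgeDeg_one X⟩ 1
      have h₂ := GradedTensorProduct.tmul_one_mul_one_tmul (R := χ) (wedgeDeg χ) (wedgeDeg χ)
        (ExteriorAlgebra.ι χ X) (ExteriorAlgebra.ι χ X)
      have h₃ := map_mul (GradedTensorProduct.includeLeft (R := χ) (wedgeDeg χ) (wedgeDeg χ))
        (ExteriorAlgebra.ι χ X) (ExteriorAlgebra.ι χ X)
      have h₄ := map_mul (GradedTensorProduct.includeRight (R := χ) (wedgeDeg χ) (wedgeDeg χ))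
        (ExteriorAlgebra.ι χ X) (ExteriorAlgebra.ι χ X)
      rw [ExteriorAlgebra.ι_sq_zero, map_zero] at h₃ h₄
      simp only [LinearMap.add_apply, LinearMap.comp_apply, AlgHom.toLinearMap_apply, mul_add,
        add_mul, ← h₃, ← h₄]
      simp only [GradedTensorProduct.includeLeft_apply, GradedTensorProduct.includeRight_apply]
      simp only [one_mul, mul_one, uzpow_one, Units.neg_smul, one_smul] at h₁
      rw [h₁, h₂]
      simp⟩

/-- `(B, α)`: the interior product filling the last slots of the multivector field `B` with the
form `α`. On decomposable fields, for a `k`-form `α`,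
`(X₁ ∧ ⋯ ∧ X_m, α) = ∑_{#S = k} sgn(Sᶜ, S) α(X_S) X_{Sᶜ}`. -/
def Multivector.inner (B : Multivector χ) {k : ℕ} : DForm χ k →ₗ[χ] Multivector χ where
  toFun α := TensorProduct.rid χ (Multivector χ)
    (LinearMap.lTensor (Multivector χ) α.eval
      ((GradedTensorProduct.of χ (wedgeDeg χ) (wedgeDeg χ)).symm (coproduct B)))
  map_add' α β := by
    simp [DForm.eval, Pi.single_add, map_add, LinearMap.lTensor_add]
  map_smul' f α := by
    simp [DForm.eval, Pi.single_smul, map_smul, LinearMap.lTensor_smul]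

instance DForm.instIsScalarTower (k : ℕ) : IsScalarTower ℝ χ (DForm χ k) :=
  ⟨fun c f α => by ext; simp⟩

/-- The codifferential `δ A = ε (-1)^(na) ∗ d ∗ A` of the volume element `η` with dual `ηs`, where
`∗ A = (η, A)` and `∗ α = (ηs, α)`. A field `A` of degree `a` contributes to the summand
`k = n - a` only. -/
def codifferential {n : ℕ} (ε : ℤˣ) (η : DForm χ n) (ηs : Multivector χ) :
    Multivector χ →ₗ[ℝ] Multivector χ :=
  ∑ k ∈ Finset.range (n + 1), (ε * (-1) ^ (n * (n - k))) •
    ((Multivector.inner ηs (k := k + 1)).restrictScalars ℝ ∘ₗ extD ∘ₗ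
      (η.inner k).restrictScalars ℝ)

/-- The Leibniz bracket, with respect to the exterior product, of an operator `P` of odd degree `p`:
`{A, B} = A ∧ P(B) + (-1)^(pa) (P(A) ∧ B - P(A ∧ B))` for `A` of degree `a`, extended bilinearly.
The sign `(-1)^(pa) = (-1)^a` is produced by the grade involution. -/
def leibnizBracket (P : Multivector χ →ₗ[ℝ] Multivector χ) :
    Multivector χ →ₗ[ℝ] Multivector χ →ₗ[ℝ] Multivector χ :=
  LinearMap.mk₂ ℝ
    (fun A B => A * P B +
      (P (CliffordAlgebra.involute A) * B - P (CliffordAlgebra.involute A * B)))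
    (by intros; simp [add_mul]; abel)
    (by
      intro c A B
      have h : CliffordAlgebra.involute (c • A) = c • CliffordAlgebra.involute A := by
        rw [← algebraMap_smul χ c A, map_smul, algebraMap_smul]
      simp [h, smul_add, smul_sub])
    (by intros; simp [mul_add]; abel) (by intros; simp [smul_add, smul_sub])

theorem involute_of_mem {a : ℕ} {A : Multivector χ} (hA : A ∈ wedgeDeg χ a) :
    CliffordAlgebra.involute A = (-1 : ℤˣ) ^ a • A := by
  rw [wedgeDeg, ← ExteriorAlgebra.ιMulti_span_fixedDegree] at hA
  induction hA using Submodule.span_induction with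
  | mem x hx =>
    obtain ⟨v, rfl⟩ := hx
    induction a with
    | zero => simp
    | succ a ih =>
      rw [ExteriorAlgebra.ιMulti_succ_apply, map_mul, ih, pow_succ]
      have : CliffordAlgebra.involute (ExteriorAlgebra.ι χ (v 0)) = -ExteriorAlgebra.ι χ (v 0) :=
        CliffordAlgebra.involute_ι (v 0)
      rw [this]
      simp [mul_smul_comm]
  | zero => simp
  | add x y _ _ hx hy => rw [map_add, hx, hy, smul_add]
  | smul f x _ hx => rw [map_smul, hx, smul_comm]

theorem leibnizBracket_apply_of_mem (P : Multivector χ →ₗ[ℝ] Multivector χ) {a : ℕ}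
    {A : Multivector χ} (hA : A ∈ wedgeDeg χ a) (B : Multivector χ) :
    leibnizBracket P A B = A * P B + (-1 : ℤˣ) ^ a • (P A * B - P (A * B)) := by
  rcases neg_one_pow_eq_or ℤˣ a with h | h <;>
    simp [leibnizBracket, involute_of_mem hA, h, sub_eq_add_neg, add_comm]

/-- The integer grading of the exterior contravariant algebra: degree `a` multivector fields, and
zero in negative degrees. -/
def multivectorDeg (χ : Type*) [CommRing χ] [Algebra ℝ χ] : ℤ → Submodule ℝ (Multivector χ)
  | Int.ofNat a => (wedgeDeg χ a).restrictScalars ℝ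
  | Int.negSucc _ => ⊥

/-- For a form `γ` and a field `B`, the component of degree `a` of the form `d(γ, B)`. -/
def dInner {m : ℕ} (γ : DForm χ m) (B : Multivector χ) : ∀ a : ℕ, DForm χ a
  | 0 => 0
  | k + 1 => extD (γ.inner k B)

/-- The Schouten bracket of multivector fields, characterised by its action on closed forms: for
`A`, `B` of degrees `a`, `b`, the field `{A, B}` has degree `a + b - 1` and
`i({A, B})γ = (d(γ, B), A) + (-1)^(ab) (d(γ, A), B)` for all closed `(a + b - 1)`-forms `γ`. -/
def IsSchoutenBracket (S : Multivector χ →ₗ[ℝ] Multivector χ →ₗ[ℝ] Multivector χ) : Prop :=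
  ∀ (a b : ℕ), ∀ A ∈ wedgeDeg χ a, ∀ B ∈ wedgeDeg χ b,
    S A B ∈ multivectorDeg χ ((a : ℤ) + b - 1) ∧
      ∀ (m : ℕ), m + 1 = a + b → ∀ γ : DForm χ m, extD γ = 0 →
        γ.eval (S A B) = (dInner γ B a).eval A + (-1) ^ (a * b) * (dInner γ A b).eval B

end Exterior

/-- A `k`-graded Lie algebra: a graded module with a bilinear bracket of degree `k` that is graded
anticommutative and satisfies the graded Jacobi identity. -/
structure IsGradedLieAlgebra {E : Type*} [AddCommGroup E] [Module ℝ E] (𝒜 : ℤ → Submodule ℝ E)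
    (k : ℤ) (br : E →ₗ[ℝ] E →ₗ[ℝ] E) : Prop where
  internal : DirectSum.IsInternal 𝒜
  degree : ∀ a b : ℤ, ∀ A ∈ 𝒜 a, ∀ B ∈ 𝒜 b, br A B ∈ 𝒜 (a + b + k)
  anticomm : ∀ a b : ℤ, ∀ A ∈ 𝒜 a, ∀ B ∈ 𝒜 b,
    br A B = -(((a + k) * (b + k)).negOnePow • br B A)
  jacobi : ∀ a b c : ℤ, ∀ A ∈ 𝒜 a, ∀ B ∈ 𝒜 b, ∀ C ∈ 𝒜 c,
    ((a + k) * (c + k)).negOnePow • br (br A B) C +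
      ((b + k) * (a + k)).negOnePow • br (br B C) A +
      ((c + k) * (b + k)).negOnePow • br (br C A) B = 0

end

/-! The proof moves every statement about δ from multivector fields to differential forms, where
Cartan calculus is available. The exterior algebra acts on inhomogeneous forms by `rightAction A φ =
φ(· ∧ A)`. The star operator A ↦ (η, A) intertwines left multiplication with this action
(`hodgeStar_mul`) and turns δ into Δ = `formDelta`, the exterior derivative followed by the sign of
the degree (`hodgeStar_codifferential`). It is injective, because contracting η⋆ with (η, A) gives
back ±A; this uses η⋆ ∧ X = 0 for every vector field X.

With supercommutators, Cartan calculus gives [Δ, X] = -L_X, [L_X, Y] = [X, Y], [L_X, g] = X g, [[Δ,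
f], X] = -X f and [[Δ, f], g] = 0. Hence Δ has second order (`isSecondOrderOp_formDelta`): every
[[Δ, A], B] is the action of some multivector field. Applying it to ∗1, which Δ annihilates,
identifies that field as -S(A, B), where S(A, B) = (-1)^a A ∧ δB + δA ∧ B - δ(A ∧ B) = (-1)^a {A,
B}_δ (`rightAction_schoutenBracket`).

It follows that S(A, ·) is a derivation of the exterior product. Since δ² = 0, the operator δ is an
antiderivation of S. As S is built from the product and δ, S(A, ·) is also a derivation of S, which
is the Jacobi identity. Evaluating the double commutator on a closed form gives the defining formula
of the Schouten bracket.

Uniqueness holds because a multivector field killed by all closed forms vanishes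
(`HasLocalFrames.eq_zero_of_closed`): for closed φ the form d(gφ) = dg ∧ φ is closed, so the
contractions with all dg vanish by induction on the degree, and in a local frame these determine the
field.

The manifold enters only through `HasLocalFrames`, which follows from Hadamard's lemma and bump
functions. Global finiteness comes from the volume element: by Cramer's rule an invertible pairing
η(η⋆) yields a finite dual basis of the vector fields. -/

noncomputable section

/-! ### Cartan calculus on inhomogeneous differential forms. -/

section Forms

variable {χ : Type*} [CommRing χ] [Algebra ℝ χ]

/-- Inhomogeneous differential forms, as linear functionals on multivector fields. -/
def FormSum (χ : Type*) [CommRing χ] [Algebra ℝ χ] : Type _ :=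
  Multivector χ →ₗ[χ] χ

namespace FormSum

instance : AddCommGroup (FormSum χ) := inferInstanceAs (AddCommGroup (Multivector χ →ₗ[χ] χ))

instance : Module χ (FormSum χ) := inferInstanceAs (Module χ (Multivector χ →ₗ[χ] χ))

instance : Module ℝ (FormSum χ) := inferInstanceAs (Module ℝ (Multivector χ →ₗ[χ] χ))

instance : FunLike (FormSum χ) (Multivector χ) χ :=
  inferInstanceAs (FunLike (Multivector χ →ₗ[χ] χ) _ _)

instance : LinearMapClass (FormSum χ) χ (Multivector χ) χ :=
  inferInstanceAs (LinearMapClass (Multivector χ →ₗ[χ] χ) χ _ _)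

/-- The form given by a linear functional. -/
def of (φ : Multivector χ →ₗ[χ] χ) : FormSum χ := φ

/-- The linear functional underlying a form. -/
def toLinearMap (φ : FormSum χ) : Multivector χ →ₗ[χ] χ := φ

@[simp] theorem of_apply (φ : Multivector χ →ₗ[χ] χ) (A : Multivector χ) : of φ A = φ A := rfl

@[simp] theorem toLinearMap_apply (φ : FormSum χ) (A : Multivector χ) :
    φ.toLinearMap A = φ A := rfl

@[simp] theorem add_apply (φ ψ : FormSum χ) (A : Multivector χ) : (φ + ψ) A = φ A + ψ A := rfl

@[simp] theorem sub_apply (φ ψ : FormSum χ) (A : Multivector χ) : (φ - ψ) A = φ A - ψ A := rfl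

@[simp] theorem neg_apply (φ : FormSum χ) (A : Multivector χ) : (-φ) A = -φ A := rfl

@[simp] theorem zero_apply (A : Multivector χ) : (0 : FormSum χ) A = 0 := rfl

@[simp] theorem smul_apply (f : χ) (φ : FormSum χ) (A : Multivector χ) :
    (f • φ) A = f * φ A := rfl

@[simp] theorem real_smul_apply (c : ℝ) (φ : FormSum χ) (A : Multivector χ) :
    (c • φ) A = c • φ A := rfl

@[simp] theorem units_smul_apply (s : ℤˣ) (φ : FormSum χ) (A : Multivector χ) :
    (s • φ) A = s • φ A := by
  rcases Int.units_eq_one_or s with rfl | rfl <;> simp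

theorem ext {φ ψ : FormSum χ} (h : ∀ A, φ A = ψ A) : φ = ψ := LinearMap.ext h

end FormSum

theorem wedgeDeg_induction {P : ℕ → Multivector χ → Prop}
    (algebraMap : ∀ f, P 0 (algebraMap χ _ f))
    (ι_mul : ∀ a X A, A ∈ wedgeDeg χ a → P a A → P (a + 1) (ExteriorAlgebra.ι χ X * A))
    (add : ∀ a A B, P a A → P a B → P a (A + B))
    {a : ℕ} {A : Multivector χ} (hA : A ∈ wedgeDeg χ a) : P a A := by
  induction a generalizing A with
  | zero =>
    rw [wedgeDeg, ExteriorAlgebra.exteriorPower, pow_zero, Submodule.mem_one] at hA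
    obtain ⟨f, rfl⟩ := hA
    exact algebraMap f
  | succ a ih =>
    rw [wedgeDeg, ExteriorAlgebra.exteriorPower, pow_succ'] at hA
    refine Submodule.mul_induction_on hA ?_ (add _)
    rintro _ ⟨X, rfl⟩ y hy
    exact ι_mul a X y hy (ih hy)

theorem algebraMap_mem_wedgeDeg (f : χ) : algebraMap χ (Multivector χ) f ∈ wedgeDeg χ 0 := by
  rw [wedgeDeg, ExteriorAlgebra.exteriorPower, pow_zero, Submodule.mem_one]
  exact ⟨f, rfl⟩

theorem mul_mem_wedgeDeg {a b : ℕ} {A B : Multivector χ} (hA : A ∈ wedgeDeg χ a)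
    (hB : B ∈ wedgeDeg χ b) : A * B ∈ wedgeDeg χ (a + b) :=
  SetLike.GradedMul.mul_mem (A := wedgeDeg χ) hA hB

theorem ιMulti_mem_wedgeDeg (k : ℕ) (v : Fin k → VField χ) :
    ExteriorAlgebra.ιMulti χ k v ∈ wedgeDeg χ k := by
  rw [wedgeDeg, ← ExteriorAlgebra.ιMulti_span_fixedDegree]
  exact Submodule.subset_span ⟨v, rfl⟩

theorem multivector_induction {P : Multivector χ → Prop}
    (homogeneous : ∀ a, ∀ A ∈ wedgeDeg χ a, P A) (add : ∀ A B, P A → P B → P (A + B))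
    (A : Multivector χ) : P A :=
  DirectSum.Decomposition.inductionOn (wedgeDeg χ) (homogeneous 0 0 (zero_mem _))
    (fun {i} m => homogeneous i m m.2) add A

theorem FormSum.ext_homogeneous {φ ψ : FormSum χ}
    (h : ∀ k, ∀ A ∈ wedgeDeg χ k, φ A = ψ A) : φ = ψ :=
  FormSum.ext fun A => multivector_induction h
    (fun A B hA hB => by rw [map_add, map_add, hA, hB]) A

theorem FormSum.ext_ιMulti {φ ψ : FormSum χ}
    (h : ∀ k v, φ (ExteriorAlgebra.ιMulti χ k v) = ψ (ExteriorAlgebra.ιMulti χ k v)) : φ = ψ :=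
  ExteriorAlgebra.lhom_ext fun k => AlternatingMap.ext (h k)

theorem ι_mul_ιMulti {k : ℕ} (X : VField χ) (v : Fin k → VField χ) :
    ExteriorAlgebra.ι χ X * ExteriorAlgebra.ιMulti χ k v =
      ExteriorAlgebra.ιMulti χ (k + 1) (Matrix.vecCons X v) := by
  rw [ExteriorAlgebra.ιMulti_succ_apply]
  rfl

theorem involute_ιMulti {k : ℕ} (v : Fin k → VField χ) :
    (CliffordAlgebra.involute (ExteriorAlgebra.ιMulti χ k v) : Multivector χ) =
      (-1 : ℤˣ) ^ k • ExteriorAlgebra.ιMulti χ k v :=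
  involute_of_mem (ιMulti_mem_wedgeDeg k v)

theorem involute_ι_mul (X : VField χ) (A : Multivector χ) :
    (CliffordAlgebra.involute (ExteriorAlgebra.ι χ X * A) : Multivector χ) =
      -(ExteriorAlgebra.ι χ X * CliffordAlgebra.involute A) := by
  rw [map_mul, ← neg_mul]
  exact congrArg (· * _) (CliffordAlgebra.involute_ι X)

/-- Multivector fields of degrees `a` and `b` commute up to the sign `(-1)^(ab)`. -/
theorem wedge_comm {a b : ℕ} {A B : Multivector χ} (hA : A ∈ wedgeDeg χ a)
    (hB : B ∈ wedgeDeg χ b) : A * B = (-1 : ℤˣ) ^ (a * b) • (B * A) := by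
  have h1 : ∀ (X : VField χ) (b : ℕ), ∀ B ∈ wedgeDeg χ b,
      ExteriorAlgebra.ι χ X * B = (-1 : ℤˣ) ^ b • (B * ExteriorAlgebra.ι χ X) := by
    intro X b B hB
    refine wedgeDeg_induction (P := fun b B => ExteriorAlgebra.ι χ X * B =
      (-1 : ℤˣ) ^ b • (B * ExteriorAlgebra.ι χ X)) ?_ ?_ ?_ hB
    · intro f
      simp [Algebra.commutes]
    · intro b Y B _ ih
      have := ExteriorAlgebra.ι_add_mul_swap (R := χ) X Y
      rw [← mul_assoc, eq_neg_of_add_eq_zero_left this, neg_mul, mul_assoc, ih, pow_succ,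
        mul_smul_comm, mul_assoc]
      simp
    · intro a A B hA hB
      rw [mul_add, hA, hB, add_mul, smul_add]
  refine wedgeDeg_induction (P := fun a A => A * B = (-1 : ℤˣ) ^ (a * b) • (B * A))
    ?_ ?_ ?_ hA
  · intro f
    simp [Algebra.commutes]
  · intro a X A hA ih
    rw [mul_assoc, ih, mul_smul_comm, ← mul_assoc, h1 X b B hB, smul_mul_assoc, smul_smul,
      ← pow_add, mul_assoc, add_mul, one_mul]
  · intro a A B hA hB
    rw [add_mul, hA, hB, mul_add, smul_add]

/-- The transpose of right multiplication by a multivector field. -/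
def rightContract : Multivector χ →ₗ[ℝ] Module.End ℝ (FormSum χ) :=
  LinearMap.mk₂ ℝ (fun A φ => FormSum.of (φ.toLinearMap ∘ₗ LinearMap.mulRight χ A))
    (fun A A' φ => FormSum.ext fun B => by simp [mul_add])
    (fun c A φ => FormSum.ext fun B => by simp)
    (by intros; rfl) (by intros; rfl)

@[simp]
theorem rightContract_apply (A B : Multivector χ) (φ : FormSum χ) :
    rightContract A φ B = φ (B * A) := rfl

/-- The transpose of left multiplication by a vector field. -/
def leftContract : VField χ →ₗ[ℝ] Module.End ℝ (FormSum χ) :=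
  LinearMap.mk₂ ℝ
    (fun X φ => FormSum.of (φ.toLinearMap ∘ₗ LinearMap.mulLeft χ (ExteriorAlgebra.ι χ X)))
    (fun X X' φ => FormSum.ext fun B => by simp [add_mul])
    (fun c X φ => FormSum.ext fun B => by
      have : ExteriorAlgebra.ι χ (c • X) = c • ExteriorAlgebra.ι χ X := by
        rw [← algebraMap_smul χ c X, map_smul, algebraMap_smul]
      simp [this])
    (by intros; rfl) (by intros; rfl)

@[simp]
theorem leftContract_apply (X : VField χ) (φ : FormSum χ) (B : Multivector χ) :
    leftContract X φ B = φ (ExteriorAlgebra.ι χ X * B) := rfl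

/-- The grade involution of forms. -/
def formInvolute : Module.End ℝ (FormSum χ) where
  toFun φ := FormSum.of (φ.toLinearMap ∘ₗ
    (CliffordAlgebra.involute : Multivector χ →ₐ[χ] Multivector χ).toLinearMap)
  map_add' _ _ := rfl
  map_smul' _ _ := rfl

@[simp]
theorem formInvolute_apply (φ : FormSum χ) (B : Multivector χ) :
    formInvolute φ B = φ (CliffordAlgebra.involute B) := rfl

/-- Multiplication of forms by functions. -/
def formMul : χ →+* Module.End ℝ (FormSum χ) where
  toFun f :=
    { toFun φ := f • φ
      map_add' φ ψ := smul_add f φ ψ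
      map_smul' c φ := FormSum.ext fun A => by simp }
  map_one' := LinearMap.ext fun φ => one_smul χ φ
  map_mul' f g := LinearMap.ext fun φ => mul_smul f g φ
  map_zero' := LinearMap.ext fun φ => zero_smul χ φ
  map_add' f g := LinearMap.ext fun φ => add_smul f g φ

@[simp]
theorem formMul_apply (f : χ) (φ : FormSum χ) (B : Multivector χ) :
    formMul f φ B = f * φ B := rfl

/-- The component of degree `k` of an inhomogeneous form. -/
def FormSum.component (φ : FormSum χ) (k : ℕ) : DForm χ k :=
  φ.toLinearMap.compAlternatingMap (ExteriorAlgebra.ιMulti χ k)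

@[simp]
theorem FormSum.component_apply (φ : FormSum χ) (k : ℕ) (v : Fin k → VField χ) :
    φ.component k v = φ (ExteriorAlgebra.ιMulti χ k v) := rfl

/-- The exterior derivative of inhomogeneous forms. -/
def formD : Module.End ℝ (FormSum χ) where
  toFun φ := FormSum.of <| ExteriorAlgebra.liftAlternating fun
    | 0 => 0
    | k + 1 => extD (φ.component k)
  map_add' φ ψ := by
    refine FormSum.ext_ιMulti fun k v => ?_
    rw [FormSum.add_apply]
    simp only [FormSum.of_apply, ExteriorAlgebra.liftAlternating_apply_ιMulti]
    cases k with
    | zero => simp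
    | succ k => exact congrArg (fun β => β v) (extD.map_add (φ.component k) (ψ.component k))
  map_smul' c φ := by
    refine FormSum.ext_ιMulti fun k v => ?_
    rw [RingHom.id_apply, FormSum.real_smul_apply]
    simp only [FormSum.of_apply, ExteriorAlgebra.liftAlternating_apply_ιMulti]
    cases k with
    | zero => simp
    | succ k => exact congrArg (fun β => β v) (extD.map_smul c (φ.component k))

@[simp]
theorem formD_one (φ : FormSum χ) : formD φ 1 = 0 := by
  simp [formD]

theorem formD_ιMulti (φ : FormSum χ) {k : ℕ} (v : Fin (k + 1) → VField χ) :
    formD φ (ExteriorAlgebra.ιMulti χ (k + 1) v) = extD (φ.component k) v := by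
  exact ExteriorAlgebra.liftAlternating_apply_ιMulti _ v

/-- The Lie derivative of forms, by the homotopy formula. -/
def formLie (X : VField χ) : Module.End ℝ (FormSum χ) :=
  formD * leftContract X + leftContract X * formD

theorem formLie_one (X : VField χ) (φ : FormSum χ) : formLie X φ 1 = X (φ 1) := by
  have : ExteriorAlgebra.ι χ X * 1 = ExteriorAlgebra.ιMulti χ 1 ![X] := by
    rw [← ι_mul_ιMulti, ExteriorAlgebra.ιMulti_zero_apply]
  simp only [formLie, LinearMap.add_apply, FormSum.add_apply, Module.End.mul_apply, formD_one,
    leftContract_apply,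
    this, formD_ιMulti, zero_add]
  change X (φ.component 0 ![]) = _
  simp

/-- In the Koszul formula for dφ(X, v), the terms that keep X as an argument cancel against the
Koszul formula for d(i_X φ)(v). Only the derivative along X and the brackets with X survive. -/
theorem formLie_ιMulti (X : VField χ) (φ : FormSum χ) {k : ℕ} (v : Fin k → VField χ) :
    formLie X φ (ExteriorAlgebra.ιMulti χ k v) = X (φ (ExteriorAlgebra.ιMulti χ k v)) -
      ∑ j, φ (ExteriorAlgebra.ιMulti χ k (Function.update v j ⁅X, v j⁆)) := by
  cases k with
  | zero => simp [formLie_one]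
  | succ k =>
    simp only [formLie, LinearMap.add_apply, FormSum.add_apply, Module.End.mul_apply,
      leftContract_apply,
      ι_mul_ιMulti, formD_ιMulti]
    -- Moving the bracket from the front into slot `j` costs (-1)^j, which absorbs the Koszul sign.
    have h0 : ∀ j : Fin (k + 1), (-1) ^ (((0 : Fin (k + 1)) : ℕ) + (j : ℕ)) *
        φ.component (k + 1) (Matrix.vecCons ⁅Matrix.vecCons X v (Fin.castSucc 0),
          Matrix.vecCons X v j.succ⁆
          (j.removeNth ((Fin.castSucc 0).removeNth (Matrix.vecCons X v)))) =
        φ (ExteriorAlgebra.ιMulti χ (k + 1) (Function.update v j ⁅X, v j⁆)) := by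
      intro j
      have h1 : (Fin.castSucc 0).removeNth (Matrix.vecCons X v) = v := by
        funext j
        simp [Fin.removeNth]
      rw [h1, ← Fin.insertNth_removeNth, ← FormSum.component_apply, AlternatingMap.map_insertNth]
      simp [zsmul_eq_mul]
    change koszulFormula ((leftContract X φ).component k) v +
      koszulFormula (φ.component (k + 1)) (Matrix.vecCons X v) = _
    rw [koszulFormula_vecCons, Finset.sum_congr rfl fun j _ => h0 j, FormSum.component_apply]
    suffices h : koszulFormula ((leftContract X φ).component k) v =
        -(∑ i : Fin (k + 1), (-1) ^ (i.succ : ℕ) * (Matrix.vecCons X v i.succ)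
          (φ.component (k + 1) (i.succ.removeNth (Matrix.vecCons X v)))) +
        ∑ i : Fin k, ∑ j ∈ Finset.Ici i.succ, (-1) ^ ((i.succ : ℕ) + (j : ℕ)) *
          φ.component (k + 1)
            (Matrix.vecCons ⁅Matrix.vecCons X v i.succ.castSucc, Matrix.vecCons X v j.succ⁆
          (j.removeNth (i.succ.castSucc.removeNth (Matrix.vecCons X v)))) by
      rw [h]
      ring
    cases k with
    | zero => simp [koszulFormula, Fin.removeNth, Matrix.vecCons]
    | succ k =>
      simp only [koszulFormula]
      rw [sub_eq_add_neg, ← Finset.sum_neg_distrib, ← Finset.sum_neg_distrib]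
      congr 1
      · refine Finset.sum_congr rfl fun i _ => ?_
        rw [removeNth_succ_vecCons]
        simp only [FormSum.component_apply, leftContract_apply, ι_mul_ιMulti, Fin.val_succ,
          Matrix.cons_val_succ, pow_succ]
        ring
      · refine Finset.sum_congr rfl fun i _ => ?_
        -- Both indices shift by one, which leaves the sign unchanged; the minus comes from
        -- exchanging X with the bracket in the first two slots.
        rw [← Fin.map_succEmb_Ici, Finset.sum_map, ← Finset.sum_neg_distrib]
        refine Finset.sum_congr rfl fun j _ => ?_
        rw [Fin.coe_succEmb, ← Fin.succ_castSucc, removeNth_succ_vecCons, removeNth_succ_vecCons]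
        simp only [FormSum.component_apply, leftContract_apply, ← ι_mul_ιMulti, Fin.val_succ,
          Matrix.cons_val_succ]
        rw [← mul_assoc, ← mul_assoc,
          eq_neg_of_add_eq_zero_left (ExteriorAlgebra.ι_add_mul_swap (R := χ) X _), neg_mul,
          map_neg]
        simp only [pow_succ, pow_add]
        ring

/-- The Lie derivative and the contraction satisfy `[L_X, i_Y] = i_[X,Y]`. -/
theorem formLie_mul_leftContract (X Y : VField χ) :
    formLie X * leftContract Y = leftContract Y * formLie X + leftContract ⁅X, Y⁆ := by
  refine LinearMap.ext fun φ => FormSum.ext_ιMulti fun k v => ?_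
  simp only [Module.End.mul_apply, LinearMap.add_apply, FormSum.add_apply, leftContract_apply,
    formLie_ιMulti,
    ι_mul_ιMulti, Fin.sum_univ_succ]
  have h : ∀ j : Fin k, Function.update (Matrix.vecCons Y v) j.succ ⁅X, Matrix.vecCons Y v j.succ⁆ =
      Matrix.vecCons Y (Function.update v j ⁅X, v j⁆) := by
    intro j
    exact (Fin.cons_update (α := fun _ => VField χ) Y v j ⁅X, v j⁆).symm
  have h0 : Function.update (Matrix.vecCons Y v) 0 ⁅X, Matrix.vecCons Y v 0⁆ =
      Matrix.vecCons ⁅X, Y⁆ v := Fin.update_cons_zero (α := fun _ => VField χ) Y v _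
  simp only [h, h0]
  ring

/-- An operator on forms that commutes or anticommutes with all contractions is determined by its
components of degree zero. -/
theorem formEnd_eq_zero {T : Module.End ℝ (FormSum χ)} (s : ℤˣ) (h1 : ∀ φ, T φ 1 = 0)
    (h : ∀ X, leftContract X * T = s • (T * leftContract X)) : T = 0 := by
  refine LinearMap.ext fun φ => FormSum.ext_ιMulti fun k v => ?_
  induction k generalizing φ with
  | zero => simpa using h1 φ
  | succ k ih =>
    rw [ExteriorAlgebra.ιMulti_succ_apply, ← leftContract_apply, ← Module.End.mul_apply, h]
    have := ih (leftContract (v 0) φ) (Matrix.vecTail v)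
    rcases Int.units_eq_one_or s with rfl | rfl
    · simpa using this
    · simpa using this

theorem formEnd_ext {T U : Module.End ℝ (FormSum χ)} (h1 : ∀ φ, T φ 1 = U φ 1)
    (h : ∀ X, leftContract X * (T - U) = (T - U) * leftContract X) : T = U :=
  sub_eq_zero.mp <| formEnd_eq_zero 1 (fun φ => by simp [h1 φ]) fun X => by simpa using h X

theorem leftContract_mul_formMul (X : VField χ) (f : χ) :
    leftContract X * formMul f = formMul f * leftContract X := rfl

/-- In degree zero this is the definition of the commutator of derivations. The two sides have the
same commutator with each contraction, by the Jacobi identity for vector fields (`h6`), so they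
agree in all degrees. -/
theorem formLie_lie (X Y : VField χ) :
    formLie X * formLie Y = formLie Y * formLie X + formLie ⁅X, Y⁆ := by
  refine formEnd_ext (fun φ => ?_) fun Z => ?_
  · simp [formLie_one, Derivation.commutator_apply]
  · have h1 := formLie_mul_leftContract X Z
    have h2 := formLie_mul_leftContract Y Z
    have h3 := formLie_mul_leftContract ⁅X, Y⁆ Z
    have h4 := formLie_mul_leftContract Y ⁅X, Z⁆
    have h5 := formLie_mul_leftContract X ⁅Y, Z⁆
    have h6 : leftContract ⁅X, ⁅Y, Z⁆⁆ = leftContract ⁅⁅X, Y⁆, Z⁆ + leftContract ⁅Y, ⁅X, Z⁆⁆ := by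
      rw [leibniz_lie, map_add]
    have h7 : formLie X * formLie Y * leftContract Z = formLie X * (leftContract Z * formLie Y) +
        formLie X * leftContract ⁅Y, Z⁆ := by rw [mul_assoc, h2, mul_add]
    have h8 : formLie Y * formLie X * leftContract Z = formLie Y * (leftContract Z * formLie X) +
        formLie Y * leftContract ⁅X, Z⁆ := by rw [mul_assoc, h1, mul_add]
    rw [sub_mul, add_mul, h7, h8, h3, ← mul_assoc, ← mul_assoc, h1, h2, h4, h5, h6]
    noncomm_ring

theorem leftContract_mul_formD (X : VField χ) :
    leftContract X * formD = formLie X - formD * leftContract X := by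
  rw [formLie, add_sub_cancel_left]

/-- The difference anticommutes with every contraction and has no degree zero component. -/
theorem formLie_mul_formD (X : VField χ) : formLie X * formD = formD * formLie X := by
  refine sub_eq_zero.mp <| formEnd_eq_zero (-1) (fun φ => by simp [formLie_one]) fun Y => ?_
  have h1 := formLie_mul_leftContract X Y
  have h3 := formLie_lie X Y
  have h4 : leftContract Y * (formLie X * formD) = formLie X * (formLie Y - formD * leftContract Y)
      - (formLie ⁅X, Y⁆ - formD * leftContract ⁅X, Y⁆) := by
    rw [← leftContract_mul_formD, ← leftContract_mul_formD, ← mul_assoc, ← mul_assoc, h1]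
    noncomm_ring
  have h5 : leftContract Y * (formD * formLie X) = (formLie Y * formLie X) -
      formD * (formLie X * leftContract Y - leftContract ⁅X, Y⁆) := by
    rw [h1, add_sub_cancel_right, ← mul_assoc, leftContract_mul_formD]
    noncomm_ring
  rw [mul_sub, h4, h5, mul_sub, h3]
  simp only [Units.neg_smul, one_smul]
  noncomm_ring

/-- d² commutes with i_X because d commutes with L_X, and it vanishes in degree zero. -/
theorem formD_mul_formD : (formD * formD : Module.End ℝ (FormSum χ)) = 0 := by
  refine formEnd_eq_zero 1 (fun φ => by simp) fun X => ?_
  rw [← mul_assoc, leftContract_mul_formD, sub_mul, mul_assoc, leftContract_mul_formD,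
    formLie_mul_formD, one_smul]
  noncomm_ring

theorem formLie_mul_formMul (X : VField χ) (f : χ) :
    formLie X * formMul f = formMul f * formLie X + formMul (X f) := by
  refine formEnd_ext (fun φ => ?_) fun Y => ?_
  · simp [formLie_one]
    ring
  · have h1 := formLie_mul_leftContract X Y
    have h2 : leftContract Y * (formLie X * formMul f) =
        formLie X * (formMul f * leftContract Y) - formMul f * leftContract ⁅X, Y⁆ := by
      rw [← leftContract_mul_formMul, ← leftContract_mul_formMul, ← mul_assoc, ← mul_assoc, h1]
      noncomm_ring
    have h3 : leftContract Y * (formMul f * formLie X) =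
        formMul f * (formLie X * leftContract Y) - formMul f * leftContract ⁅X, Y⁆ := by
      rw [← mul_assoc, leftContract_mul_formMul, h1]
      noncomm_ring
    rw [mul_sub, mul_add, h2, h3, leftContract_mul_formMul]
    noncomm_ring

/-- The commutator [d, f] is exterior multiplication by df; this is the rule i_X(df ∧ φ) = (X f) φ -
df ∧ i_X φ. -/
theorem leftContract_mul_bracket (X : VField χ) (f : χ) :
    leftContract X * (formD * formMul f - formMul f * formD) =
      formMul (X f) - (formD * formMul f - formMul f * formD) * leftContract X := by
  have h2 := formLie_mul_formMul X f
  rw [mul_sub, ← mul_assoc, ← mul_assoc, leftContract_mul_formMul, leftContract_mul_formD,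
    mul_assoc (formMul f), leftContract_mul_formD, sub_mul, h2, mul_assoc formD,
    leftContract_mul_formMul]
  noncomm_ring

/-- The exterior derivative is a first order differential operator. -/
theorem formD_formMul_formMul (f g : χ) :
    (formD * formMul f - formMul f * formD) * formMul g =
      formMul g * (formD * formMul f - formMul f * formD) := by
  have hc : ∀ f g : χ, formMul f * formMul g = formMul g * formMul f := fun f g => by
    rw [← map_mul, mul_comm, map_mul]
  refine sub_eq_zero.mp <| formEnd_eq_zero (-1) (fun φ => by simp) fun X => ?_
  have h1 := leftContract_mul_bracket X f
  rw [mul_sub, ← mul_assoc, h1, ← mul_assoc, leftContract_mul_formMul, mul_assoc (formMul g), h1,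
    sub_mul, mul_assoc _ (leftContract X), leftContract_mul_formMul, mul_sub, hc g]
  simp only [Units.neg_smul, one_smul]
  noncomm_ring

end Forms

theorem map_intUnits_smul {F G H : Type*} [AddCommGroup G] [AddCommGroup H] [FunLike F G H]
    [AddMonoidHomClass F G H] (f : F) (s : ℤˣ) (x : G) : f (s • x) = s • f x := by
  rcases Int.units_eq_one_or s with rfl | rfl <;> simp

/-! ### Differential operators of order at most two over the exterior algebra. -/

section SecondOrder

variable {χ : Type*} [CommRing χ] [Algebra ℝ χ] {R : Type*} [Ring R]
  (l : Multivector χ →+* R)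

/-- Operators of parity `t` given by multiplication with a multivector field of parity `t`. -/
def IsMultOp (t : ℕ) (T : R) : Prop :=
  ∃ C : Multivector χ, (∀ b, ∀ B ∈ wedgeDeg χ b, C * B = (-1 : ℤˣ) ^ (t * b) • (B * C)) ∧ T = l C

/-- Operators of parity `t` whose supercommutators with multiplications are multiplications. -/
def IsFirstOrderOp (t : ℕ) (T : R) : Prop :=
  ∀ b, ∀ B ∈ wedgeDeg χ b, IsMultOp l (t + b) (T * l B - (-1 : ℤˣ) ^ (t * b) • (l B * T))

/-- Operators of parity `t` whose supercommutators with multiplications have first order. -/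
def IsSecondOrderOp (t : ℕ) (T : R) : Prop :=
  ∀ a, ∀ A ∈ wedgeDeg χ a, IsFirstOrderOp l (t + a) (T * l A - (-1 : ℤˣ) ^ (t * a) • (l A * T))

variable {l}

theorem isMultOp_of_mem {t : ℕ} {C : Multivector χ} (hC : C ∈ wedgeDeg χ t) :
    IsMultOp l t (l C) :=
  ⟨C, fun _ _ hB => wedge_comm hC hB, rfl⟩

/-- The index matters only through its parity, so degrees that truncated subtraction would spoil may
be replaced by any number of the same parity. -/
theorem isMultOp_congr {t t' : ℕ} {T : R} (h : IsMultOp l t T)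
    (ht : (-1 : ℤˣ) ^ t = (-1) ^ t') : IsMultOp l t' T := by
  obtain ⟨C, hC, rfl⟩ := h
  exact ⟨C, fun b B hB => by rw [hC b B hB, pow_mul, ht, pow_mul], rfl⟩

theorem IsMultOp.add {t : ℕ} {T U : R} (hT : IsMultOp l t T) (hU : IsMultOp l t U) :
    IsMultOp l t (T + U) := by
  obtain ⟨C, hC, rfl⟩ := hT
  obtain ⟨D, hD, rfl⟩ := hU
  exact ⟨C + D, fun b B hB => by rw [add_mul, mul_add, hC b B hB, hD b B hB, smul_add],
    (map_add l C D).symm⟩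

theorem IsMultOp.neg {t : ℕ} {T : R} (hT : IsMultOp l t T) : IsMultOp l t (-T) := by
  obtain ⟨C, hC, rfl⟩ := hT
  exact ⟨-C, fun b B hB => by rw [neg_mul, mul_neg, hC b B hB, smul_neg], (map_neg l C).symm⟩

theorem IsMultOp.smul {t : ℕ} {T : R} (hT : IsMultOp l t T) (s : ℤˣ) : IsMultOp l t (s • T) := by
  rcases Int.units_eq_one_or s with rfl | rfl
  · rwa [one_smul]
  · rw [Units.neg_smul, one_smul]
    exact hT.neg

theorem IsMultOp.mul_map {t a : ℕ} {T : R} (hT : IsMultOp l t T) {A : Multivector χ}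
    (hA : A ∈ wedgeDeg χ a) : IsMultOp l (t + a) (T * l A) := by
  obtain ⟨C, hC, rfl⟩ := hT
  refine ⟨C * A, fun b B hB => ?_, (map_mul l C A).symm⟩
  rw [mul_assoc, wedge_comm hA hB, mul_smul_comm, ← mul_assoc, hC b B hB, smul_mul_assoc,
    smul_smul, ← pow_add, mul_assoc, add_mul, add_comm]

theorem IsMultOp.map_mul {t a : ℕ} {T : R} (hT : IsMultOp l t T) {A : Multivector χ}
    (hA : A ∈ wedgeDeg χ a) : IsMultOp l (t + a) (l A * T) := by
  have h := (hT.mul_map hA).smul ((-1) ^ (t * a))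
  obtain ⟨C, hC, rfl⟩ := hT
  rwa [← _root_.map_mul, hC a A hA, map_intUnits_smul l, smul_smul, ← mul_pow, neg_one_mul, neg_neg,
    one_pow, one_smul, _root_.map_mul] at h

theorem map_wedge_comm {a b : ℕ} {A B : Multivector χ} (hA : A ∈ wedgeDeg χ a)
    (hB : B ∈ wedgeDeg χ b) : l A * l B = (-1 : ℤˣ) ^ (a * b) • (l B * l A) := by
  rw [← map_mul, wedge_comm hA hB, map_intUnits_smul l, map_mul]

/-- The supercommutator with T is a derivation, [T, X ∧ A] = [T, X] A ± X [T, A], so functions and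
vector fields suffice. -/
theorem isFirstOrderOp_of_generators {t : ℕ} {T : R}
    (hf : ∀ f, IsMultOp l t (T * l (algebraMap χ _ f) - l (algebraMap χ _ f) * T))
    (hX : ∀ X, IsMultOp l (t + 1)
      (T * l (ExteriorAlgebra.ι χ X) - (-1 : ℤˣ) ^ t • (l (ExteriorAlgebra.ι χ X) * T))) :
    IsFirstOrderOp l t T := by
  intro b B hB
  refine wedgeDeg_induction (P := fun b B => IsMultOp l (t + b)
    (T * l B - (-1 : ℤˣ) ^ (t * b) • (l B * T))) ?_ ?_ ?_ hB
  · intro f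
    simpa using hf f
  · intro a X A hA ih
    have h1 := (hX X).mul_map hA
    have h2 := (ih.map_mul (ι_mem_wedgeDeg_one X)).smul ((-1) ^ t)
    rw [show t + a + 1 = t + 1 + a by ring] at h2
    rw [show t + (a + 1) = t + 1 + a by ring]
    convert h1.add h2 using 1
    rw [map_mul]
    rcases neg_one_pow_eq_or ℤˣ t with ht | ht <;> rcases neg_one_pow_eq_or ℤˣ a with ha | ha <;>
      simp only [mul_add, pow_add, pow_mul, ht, ha, one_pow, one_mul,
        mul_one, neg_mul, neg_neg, one_smul, Units.neg_smul] <;>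
      noncomm_ring
  · intro a A B hA hB
    convert hA.add hB using 1
    rw [map_add, mul_add, add_mul, smul_add]
    abel

theorem IsFirstOrderOp.add {t : ℕ} {T U : R} (hT : IsFirstOrderOp l t T)
    (hU : IsFirstOrderOp l t U) : IsFirstOrderOp l t (T + U) := by
  intro b B hB
  convert (hT b B hB).add (hU b B hB) using 1
  rw [mul_add, add_mul, smul_add]
  abel

theorem IsFirstOrderOp.smul {t : ℕ} {T : R} (hT : IsFirstOrderOp l t T) (s : ℤˣ) :
    IsFirstOrderOp l t (s • T) := by
  intro b B hB
  convert (hT b B hB).smul s using 1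
  rw [mul_smul_comm, smul_mul_assoc, smul_sub, smul_comm s]

/-- Since A and B supercommute, [T A, B] = (-1)^(ab) [T, B] A. -/
theorem IsFirstOrderOp.mul_map {t a : ℕ} {T : R} (hT : IsFirstOrderOp l t T) {A : Multivector χ}
    (hA : A ∈ wedgeDeg χ a) : IsFirstOrderOp l (t + a) (T * l A) := by
  intro b B hB
  have h := ((hT b B hB).mul_map hA).smul ((-1) ^ (a * b))
  rw [show t + b + a = t + a + b by ring] at h
  convert h using 1
  rw [mul_assoc, map_wedge_comm hA hB]
  rcases neg_one_pow_eq_or ℤˣ t with ht | ht <;> rcases neg_one_pow_eq_or ℤˣ a with ha | ha <;>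
    rcases neg_one_pow_eq_or ℤˣ b with hb | hb <;>
    simp only [add_mul, pow_add, pow_mul, ht, ha, hb, one_pow, one_mul,
        mul_one, neg_mul, neg_neg, one_smul, Units.neg_smul] <;>
    noncomm_ring

theorem IsFirstOrderOp.map_mul {t a : ℕ} {T : R} (hT : IsFirstOrderOp l t T) {A : Multivector χ}
    (hA : A ∈ wedgeDeg χ a) : IsFirstOrderOp l (t + a) (l A * T) := by
  intro b B hB
  have h := ((hT b B hB).map_mul hA)
  rw [show t + b + a = t + a + b by ring] at h
  convert h using 1
  have h2 : l B * (l A * T) = (-1 : ℤˣ) ^ (b * a) • (l A * (l B * T)) := by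
    rw [← mul_assoc, map_wedge_comm hB hA, smul_mul_assoc, mul_assoc]
  rw [h2]
  rcases neg_one_pow_eq_or ℤˣ t with ht | ht <;> rcases neg_one_pow_eq_or ℤˣ a with ha | ha <;>
    rcases neg_one_pow_eq_or ℤˣ b with hb | hb <;>
    simp only [add_mul, pow_add, pow_mul, ht, ha, hb, one_pow, one_mul,
        mul_one, neg_mul, neg_neg, one_smul, Units.neg_smul] <;>
    noncomm_ring

/-- The derivation property of the supercommutator again; it now needs first order operators to be
stable under multiplication on both sides. -/
theorem isSecondOrderOp_of_generators {t : ℕ} {T : R}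
    (hf : ∀ f, IsFirstOrderOp l t (T * l (algebraMap χ _ f) - l (algebraMap χ _ f) * T))
    (hX : ∀ X, IsFirstOrderOp l (t + 1)
      (T * l (ExteriorAlgebra.ι χ X) - (-1 : ℤˣ) ^ t • (l (ExteriorAlgebra.ι χ X) * T))) :
    IsSecondOrderOp l t T := by
  intro b B hB
  refine wedgeDeg_induction (P := fun b B => IsFirstOrderOp l (t + b)
    (T * l B - (-1 : ℤˣ) ^ (t * b) • (l B * T))) ?_ ?_ ?_ hB
  · intro f
    simpa using hf f
  · intro a X A hA ih
    have h1 := (hX X).mul_map hA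
    have h2 := (ih.map_mul (ι_mem_wedgeDeg_one X)).smul ((-1) ^ t)
    rw [show t + a + 1 = t + 1 + a by ring] at h2
    rw [show t + (a + 1) = t + 1 + a by ring]
    convert h1.add h2 using 1
    rw [map_mul]
    rcases neg_one_pow_eq_or ℤˣ t with ht | ht <;> rcases neg_one_pow_eq_or ℤˣ a with ha | ha <;>
      simp only [mul_add, pow_add, pow_mul, ht, ha, one_pow, one_mul,
        mul_one, neg_mul, neg_neg, one_smul, Units.neg_smul] <;>
      noncomm_ring
  · intro a A B hA hB
    convert hA.add hB using 1
    rw [map_add, mul_add, add_mul, smul_add]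
    abel

end SecondOrder

/-! ### The exterior derivative as a second order operator for right contraction. -/

section FormLaplacian

variable {χ : Type*} [CommRing χ] [Algebra ℝ χ]

/-- Right contraction as an action of the exterior algebra on forms. -/
def rightAction : Multivector χ →+* Module.End ℝ (FormSum χ) where
  toFun := rightContract
  map_one' := LinearMap.ext fun φ => FormSum.ext fun A => by simp
  map_mul' A B := LinearMap.ext fun φ => FormSum.ext fun C => by simp [mul_assoc]
  map_zero' := map_zero _
  map_add' := map_add _

@[simp]
theorem rightAction_apply (A B : Multivector χ) (φ : FormSum χ) :
    rightAction A φ B = φ (B * A) := rfl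

theorem rightAction_algebraMap (f : χ) :
    rightAction (algebraMap χ (Multivector χ) f) = formMul f :=
  LinearMap.ext fun φ => FormSum.ext fun A => by
    simp [← Algebra.commutes, ← Algebra.smul_def]

/-- This converts right contraction by a vector field into left contraction followed by the grade
involution, so the Cartan formulas apply to `rightAction`. -/
theorem mul_ι (A : Multivector χ) (X : VField χ) :
    A * ExteriorAlgebra.ι χ X = ExteriorAlgebra.ι χ X * CliffordAlgebra.involute A := by
  induction A using multivector_induction with
  | homogeneous a A hA =>
    rw [wedge_comm hA (ι_mem_wedgeDeg_one X), involute_of_mem hA, mul_smul_comm, mul_one]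
  | add A B hA hB => rw [add_mul, hA, hB, map_add, mul_add]

theorem rightAction_ι (X : VField χ) :
    rightAction (ExteriorAlgebra.ι χ X) = formInvolute * leftContract X :=
  LinearMap.ext fun φ => FormSum.ext fun A => by simp [mul_ι]

theorem formInvolute_mul_self : (formInvolute * formInvolute : Module.End ℝ (FormSum χ)) = 1 :=
  LinearMap.ext fun φ => FormSum.ext fun A => by simp

theorem formInvolute_mul_leftContract (X : VField χ) :
    formInvolute * leftContract X = -(leftContract X * formInvolute) :=
  LinearMap.ext fun φ => FormSum.ext fun A => by simp [involute_ι_mul]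

theorem formInvolute_mul_formMul (f : χ) :
    formInvolute * formMul f = formMul f * formInvolute := rfl

theorem formInvolute_mul_formD :
    (formInvolute * formD : Module.End ℝ (FormSum χ)) = -(formD * formInvolute) := by
  refine LinearMap.ext fun φ => FormSum.ext_ιMulti fun k v => ?_
  cases k with
  | zero => simp
  | succ k =>
    simp only [Module.End.mul_apply, LinearMap.neg_apply, FormSum.neg_apply, formInvolute_apply,
      involute_ιMulti, map_intUnits_smul, formD_ιMulti]
    have : (formInvolute φ).component k = (-1 : ℤˣ) ^ k • φ.component k := by
      ext v
      simp [involute_ιMulti]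
    rw [this, map_intUnits_smul, pow_succ]
    rcases neg_one_pow_eq_or ℤˣ k with hk | hk <;> simp [hk]

/-- The operator on forms that corresponds to the codifferential. -/
def formDelta : Module.End ℝ (FormSum χ) := formInvolute * formD

theorem formDelta_mul_self : (formDelta * formDelta : Module.End ℝ (FormSum χ)) = 0 := by
  rw [formDelta, ← mul_assoc]
  nth_rw 1 [formInvolute_mul_formD]
  rw [neg_mul, mul_assoc formD, formInvolute_mul_self, mul_one, neg_mul, formD_mul_formD, neg_zero]

theorem formInvolute_mul_formLie (X : VField χ) :
    formInvolute * formLie X = formLie X * formInvolute := by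
  rw [formLie, mul_add, ← mul_assoc, ← mul_assoc, formInvolute_mul_formD,
    formInvolute_mul_leftContract, neg_mul, mul_assoc, formInvolute_mul_leftContract, neg_mul,
    mul_assoc, formInvolute_mul_formD]
  noncomm_ring

/-- The involution anticommutes with both d and i_X. In each product the two involutions cancel at
the cost of a sign, and Cartan's homotopy formula remains. -/
theorem formDelta_ι (X : VField χ) :
    formDelta * rightAction (ExteriorAlgebra.ι χ X) +
      rightAction (ExteriorAlgebra.ι χ X) * formDelta = -formLie X := by
  have h1 : formDelta * rightAction (ExteriorAlgebra.ι χ X) = -(formD * leftContract X) := by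
    rw [formDelta, rightAction_ι, formInvolute_mul_formD, neg_mul, mul_assoc, ← mul_assoc
      formInvolute, formInvolute_mul_self, one_mul]
  have h2 : rightAction (ExteriorAlgebra.ι χ X) * formDelta = -(leftContract X * formD) := by
    rw [formDelta, rightAction_ι, formInvolute_mul_leftContract, neg_mul, mul_assoc, ← mul_assoc
      formInvolute, formInvolute_mul_self, one_mul]
  rw [h1, h2, formLie]
  abel

theorem formLie_rightAction_ι (X Y : VField χ) :
    formLie X * rightAction (ExteriorAlgebra.ι χ Y) =
      rightAction (ExteriorAlgebra.ι χ Y) * formLie X +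
        rightAction (ExteriorAlgebra.ι χ ⁅X, Y⁆) := by
  rw [rightAction_ι, rightAction_ι, ← mul_assoc, ← formInvolute_mul_formLie, mul_assoc,
    formLie_mul_leftContract]
  noncomm_ring

theorem formDelta_formMul_formMul (f g : χ) :
    (formDelta * formMul f - formMul f * formDelta) * formMul g =
      formMul g * (formDelta * formMul f - formMul f * formDelta) := by
  have h : (formDelta * formMul f - formMul f * formDelta) =
      formInvolute * (formD * formMul f - formMul f * formD) := by
    rw [formDelta, mul_sub, ← mul_assoc, ← mul_assoc, ← mul_assoc, formInvolute_mul_formMul]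
  rw [h, mul_assoc, formD_formMul_formMul, ← mul_assoc, ← mul_assoc, formInvolute_mul_formMul]

/-- On generators: [[Δ, f], g] = 0, [[Δ, f], X] = -X f and [Δ, X] = -L_X, while [L_X, g] = X g and
[L_X, Y] = [X, Y]. All the double commutators are multiplications. -/
theorem isSecondOrderOp_formDelta :
    IsSecondOrderOp (rightAction (χ := χ)) 1 formDelta := by
  refine isSecondOrderOp_of_generators (fun f => ?_) fun X => ?_
  · rw [rightAction_algebraMap]
    refine isFirstOrderOp_of_generators (fun g => ?_) fun X => ?_
    · rw [rightAction_algebraMap, formDelta_formMul_formMul, sub_self]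
      exact ⟨0, by simp, by simp⟩
    · have h : (formDelta * formMul f - formMul f * formDelta) *
          rightAction (ExteriorAlgebra.ι χ X) - (-1 : ℤˣ) ^ 1 •
          (rightAction (ExteriorAlgebra.ι χ X) * (formDelta * formMul f - formMul f * formDelta)) =
          rightAction (algebraMap χ _ (-(X f))) := by
        have h1 := formDelta_ι X
        have h2 := formLie_mul_formMul X f
        have h3 : rightAction (ExteriorAlgebra.ι χ X) * formMul f =
            formMul f * rightAction (ExteriorAlgebra.ι χ X) := by
          rw [← rightAction_algebraMap, ← map_mul, ← map_mul, Algebra.commutes]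
        have h4 : formLie X = -(formDelta * rightAction (ExteriorAlgebra.ι χ X) +
            rightAction (ExteriorAlgebra.ι χ X) * formDelta) := by rw [h1, neg_neg]
        rw [h4] at h2
        rw [rightAction_algebraMap, map_neg, eq_sub_of_add_eq' h2.symm]
        simp only [pow_one, Units.neg_smul, one_smul, sub_mul, mul_sub, add_mul, neg_mul,
          mul_assoc, h3]
        simp only [← mul_assoc, h3]
        noncomm_ring
      rw [h]
      exact isMultOp_congr (isMultOp_of_mem (algebraMap_mem_wedgeDeg _)) (by norm_num)
  · have h : formDelta * rightAction (ExteriorAlgebra.ι χ X) - (-1 : ℤˣ) ^ 1 •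
        (rightAction (ExteriorAlgebra.ι χ X) * formDelta) = -formLie X := by
      rw [← formDelta_ι]
      simp
    rw [h]
    refine isFirstOrderOp_of_generators (fun g => ?_) fun Y => ?_
    · rw [rightAction_algebraMap, neg_mul, formLie_mul_formMul, ← rightAction_algebraMap,
        ← rightAction_algebraMap]
      refine isMultOp_congr (t := 0) ?_ (by norm_num)
      convert (isMultOp_of_mem (l := rightAction) (algebraMap_mem_wedgeDeg (X g))).neg using 1
      noncomm_ring
    · rw [neg_mul, formLie_rightAction_ι]
      refine isMultOp_congr (t := 1) ?_ (by norm_num)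
      convert (isMultOp_of_mem (l := rightAction) (ι_mem_wedgeDeg_one ⁅X, Y⁆)).neg using 1
      norm_num

end FormLaplacian

/-! ### Local frames, finite dual bases and detection by closed forms. -/

section Frames

variable {χ : Type*} [CommRing χ] [Algebra ℝ χ]

/-- The functions `g` for which `g X = ∑ₖ X(xₖ) Eₖ` holds for some functions `xₖ` and some
vector fields `Eₖ`, `k < n`, and all vector fields `X`. -/
def IsFrameFunction (n : ℕ) (g : χ) : Prop :=
  ∃ (x : Fin n → χ) (E : Fin n → VField χ), ∀ X : VField χ, g • X = ∑ k, X (x k) • E k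

/-- A function vanishes if it is annihilated by a power of every frame function. -/
def HasLocalFrames (χ : Type*) [CommRing χ] [Algebra ℝ χ] (n : ℕ) : Prop :=
  ∀ f : χ, (∀ g : χ, IsFrameFunction n g → ∃ N : ℕ, g ^ N * f = 0) → f = 0

/-- The differential of a function. -/
def funDifferential (f : χ) : Module.Dual χ (VField χ) where
  toFun X := X f
  map_add' _ _ := rfl
  map_smul' _ _ := rfl

@[simp]
theorem funDifferential_apply (f : χ) (X : VField χ) : funDifferential f X = X f := rfl

/-- Distribute one factor g to each of the n + 1 arguments. Each g X_i is a combination of the n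
fields E_k, so by the pigeonhole principle every term of the expansion repeats an argument. -/
theorem IsFrameFunction.pow_smul_alternatingMap {n : ℕ} {g : χ} (hg : IsFrameFunction n g)
    {W : Type*} [AddCommGroup W] [Module χ W] (τ : VField χ [⋀^Fin (n + 1)]→ₗ[χ] W)
    (X : Fin (n + 1) → VField χ) : g ^ (n + 1) • τ X = 0 := by
  obtain ⟨x, E, hE⟩ := hg
  have h1 := τ.map_smul_univ (fun _ => g) X
  rw [Finset.prod_const, Finset.card_univ, Fintype.card_fin] at h1
  rw [← h1]
  simp only [hE]
  rw [← AlternatingMap.coe_multilinearMap, MultilinearMap.map_sum]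
  refine Finset.sum_eq_zero fun r _ => ?_
  rw [MultilinearMap.map_smul_univ, AlternatingMap.coe_multilinearMap]
  have hr : ¬ Function.Injective r := fun h => by
    simpa using Fintype.card_le_of_injective r h
  rw [τ.map_eq_zero_of_not_injective (fun i => E (r i)) fun h =>
    hr (Function.Injective.of_comp h), smul_zero]

theorem HasLocalFrames.vField_eq_zero {n : ℕ} (h : HasLocalFrames χ n) {X : VField χ}
    (hX : ∀ g : χ, IsFrameFunction n g → ∃ N : ℕ, g ^ N • X = 0) : X = 0 := by
  ext f
  refine h _ fun g hg => ?_
  obtain ⟨N, hN⟩ := hX g hg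
  exact ⟨N, DFunLike.congr_fun hN f⟩

/-- Cramer's rule: multiplication by a value of an `n`-form is a sum of rank one maps. -/
theorem HasLocalFrames.apply_smul_id_mem {n : ℕ} (h : HasLocalFrames χ n) (η : DForm χ n)
    (Y : Fin n → VField χ) :
    (η Y) • (LinearMap.id : VField χ →ₗ[χ] VField χ) ∈ Submodule.span χ
      {T | ∃ (φ : Module.Dual χ (VField χ)) (e : VField χ), T = φ.smulRight e} := by
  -- τ alternates (X₀, …, X_n) ↦ η(X₁, …, X_n) X₀. With n + 1 alternating arguments it must vanish,
  -- and τ(X, Y) = 0 is Cramer's rule for η(Y) X.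
  let τ : VField χ [⋀^Fin (n + 1)]→ₗ[χ] VField χ := AlternatingMap.alternatizeUncurryFin
    { toFun := fun X => (LinearMap.toSpanSingleton χ (VField χ) X).compAlternatingMap η
      map_add' := by intros; ext; simp
      map_smul' := by intros; ext; simp; ring }
  have hτ : ∀ X, τ X = 0 := fun X => h.vField_eq_zero fun g hg =>
    ⟨n + 1, hg.pow_smul_alternatingMap τ X⟩
  cases n with
  | zero =>
    -- For n = 0 the map τ is multiplication by the scalar η, so its vanishing says that this scalar
    -- kills every vector field.
    convert Submodule.zero_mem _ using 1
    ext1 X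
    have := hτ ![X]
    simp only [τ, AlternatingMap.alternatizeUncurryFin_apply] at this
    simp at this
    rw [Subsingleton.elim Y (Fin.removeNth 0 ![X])]
    simpa using this
  | succ n =>
    let φ : Fin (n + 1) → Module.Dual χ (VField χ) := fun i =>
      { toFun := fun X => (-1) ^ (i : ℕ) * η (Matrix.vecCons X (i.removeNth Y))
        map_add' := fun X X' => by
          rw [← mul_add]
          exact congrArg (fun β => (-1) ^ (i : ℕ) * β (i.removeNth Y)) (η.curryLeft.map_add X X')
        map_smul' := fun f X => by
          rw [DForm.apply_vecCons_smul, RingHom.id_apply, smul_eq_mul]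
          ring }
    have key : η Y • (LinearMap.id : VField χ →ₗ[χ] VField χ) =
        ∑ i : Fin (n + 1), (φ i).smulRight (Y i) := by
      ext1 X
      have h1 := hτ (Matrix.vecCons X Y)
      simp only [τ, AlternatingMap.alternatizeUncurryFin_apply] at h1
      rw [Fin.sum_univ_succ] at h1
      simp only [removeNth_succ_vecCons] at h1
      simp only [Fin.val_zero, pow_zero, one_smul, Matrix.cons_val_zero, LinearMap.coe_mk,
        AddHom.coe_mk, LinearMap.compAlternatingMap_apply, LinearMap.toSpanSingleton_apply,
        Fin.val_succ, Matrix.cons_val_succ, pow_succ, mul_neg, mul_one, neg_smul,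
        Finset.sum_neg_distrib, ← sub_eq_add_neg] at h1
      have h2 : Fin.removeNth 0 (Matrix.vecCons X Y) = Y := rfl
      rw [h2, sub_eq_zero] at h1
      simp only [LinearMap.smul_apply, LinearMap.id_apply, LinearMap.sum_apply,
        LinearMap.smulRight_apply, h1]
      refine Finset.sum_congr rfl fun i _ => ?_
      change _ = ((-1) ^ (i : ℕ) * η (Matrix.vecCons X (i.removeNth Y))) • Y i
      rw [mul_smul]
      simp [← Int.cast_smul_eq_zsmul χ]
    rw [key]
    exact Submodule.sum_mem _ fun i _ => Submodule.subset_span ⟨_, _, rfl⟩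

/-- The contraction of a multivector field with a linear form. -/
abbrev contract (φ : Module.Dual χ (VField χ)) : Multivector χ →ₗ[χ] Multivector χ :=
  CliffordAlgebra.contractLeft φ

theorem contract_ι_mul (φ : Module.Dual χ (VField χ)) (X : VField χ) (A : Multivector χ) :
    contract φ (ExteriorAlgebra.ι χ X * A) =
      φ X • A - ExteriorAlgebra.ι χ X * contract φ A :=
  CliffordAlgebra.contractLeft_ι_mul (d := φ) X A

theorem contract_algebraMap (φ : Module.Dual χ (VField χ)) (f : χ) :
    contract φ (algebraMap χ (Multivector χ) f) = 0 :=
  CliffordAlgebra.contractLeft_algebraMap (Q := 0) (d := φ) f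

theorem contract_mem (φ : Module.Dual χ (VField χ)) {m : ℕ} {A : Multivector χ}
    (hA : A ∈ wedgeDeg χ (m + 1)) : contract φ A ∈ wedgeDeg χ m := by
  -- The induction runs through all degrees, so its motive keeps degree 0, where the contraction
  -- vanishes, apart from the successor degrees.
  refine wedgeDeg_induction (P := fun k A => contract φ A = 0 ∧ k = 0 ∨
    ∃ m, k = m + 1 ∧ contract φ A ∈ wedgeDeg χ m) ?_ ?_ ?_ hA |>.elim (fun h => by simp at h) ?_
  · intro f
    exact Or.inl ⟨contract_algebraMap φ f, rfl⟩
  · intro a X A hA ih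
    refine Or.inr ⟨a, rfl, ?_⟩
    rw [contract_ι_mul]
    refine Submodule.sub_mem _ (Submodule.smul_mem _ _ hA) ?_
    rcases ih with ⟨h, rfl⟩ | ⟨m, rfl, h⟩
    · simp [h]
    · rw [add_comm m 1]
      exact mul_mem_wedgeDeg (ι_mem_wedgeDeg_one X) h
  · rintro a A B (⟨hA, rfl⟩ | ⟨m, rfl, hA⟩) (⟨hB, h⟩ | ⟨m', h, hB⟩)
    · exact Or.inl ⟨by rw [map_add, hA, hB, add_zero], rfl⟩
    · omega
    · omega
    · obtain rfl : m = m' := by omega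
      exact Or.inr ⟨m, rfl, by rw [map_add]; exact add_mem hA hB⟩
  · rintro ⟨m', h, h'⟩
    obtain rfl : m = m' := by omega
    exact h'

/-- Euler's identity. -/
theorem sum_ι_mul_contract {κ : Type*} [Fintype κ] {g : χ} {φ : κ → Module.Dual χ (VField χ)}
    {e : κ → VField χ} (h : ∀ X, g • X = ∑ i, φ i X • e i) {m : ℕ} {A : Multivector χ}
    (hA : A ∈ wedgeDeg χ m) :
    ∑ i, ExteriorAlgebra.ι χ (e i) * contract (φ i) A = (g * (m : χ)) • A := by
  refine wedgeDeg_induction (P := fun m A => ∑ i, ExteriorAlgebra.ι χ (e i) * contract (φ i) A =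
    (g * (m : χ)) • A) ?_ ?_ ?_ hA
  · intro f
    simp
  · intro a X A _ ih
    have h1 : ∀ i, ExteriorAlgebra.ι χ (e i) * contract (φ i) (ExteriorAlgebra.ι χ X * A) =
        ExteriorAlgebra.ι χ (φ i X • e i) * A +
          ExteriorAlgebra.ι χ X * (ExteriorAlgebra.ι χ (e i) * contract (φ i) A) := by
      intro i
      rw [contract_ι_mul, mul_sub, ← mul_assoc, ← mul_assoc,
        eq_neg_of_add_eq_zero_left (ExteriorAlgebra.ι_add_mul_swap (e i) X)]
      simp
    simp only [h1, Finset.sum_add_distrib, ← Finset.sum_mul, ← Finset.mul_sum, ← map_sum]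
    rw [ih, ← h, map_smul, smul_mul_assoc, mul_smul_comm, ← add_smul]
    congr 1
    push_cast
    ring
  · intro a A B hA hB
    simp only [map_add, mul_add, Finset.sum_add_distrib, hA, hB, smul_add]

theorem smul_succ_eq_zero {m : ℕ} {A : Multivector χ} (h : ((m + 1 : ℕ) : χ) • A = 0) : A = 0 := by
  have h2 : algebraMap ℝ χ ((m + 1 : ℕ) : ℝ)⁻¹ * ((m + 1 : ℕ) : χ) = 1 := by
    rw [← map_natCast (algebraMap ℝ χ), ← map_mul, inv_mul_cancel₀ (by positivity), map_one]
  rw [← one_smul χ A, ← h2, mul_smul, h, smul_zero]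

/-- An `n`-form and an `n`-vector field with invertible pairing give a finite dual basis. -/
theorem HasLocalFrames.exists_dualBasis {n : ℕ} (h : HasLocalFrames χ n) {η : DForm χ n}
    {ηs : Multivector χ} (hηs : ηs ∈ wedgeDeg χ n) (hη : IsUnit (η.eval ηs)) :
    ∃ (κ : ℕ) (φ : Fin κ → Module.Dual χ (VField χ)) (e : Fin κ → VField χ),
      ∀ X, (1 : χ) • X = ∑ i, φ i X • e i := by
  -- Decomposable fields span degree n, and η⋆ need not be decomposable. For A = η⋆ the scalar is a
  -- unit, and dividing by it makes the identity a finite sum of rank one maps.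
  have h1 : ∀ A ∈ wedgeDeg χ n, (η.eval A) • (LinearMap.id : VField χ →ₗ[χ] VField χ) ∈
      Submodule.span χ
        {T | ∃ (φ : Module.Dual χ (VField χ)) (e : VField χ), T = φ.smulRight e} := by
    intro A hA
    rw [wedgeDeg, ← ExteriorAlgebra.ιMulti_span_fixedDegree] at hA
    induction hA using Submodule.span_induction with
    | mem x hx =>
      obtain ⟨Y, rfl⟩ := hx
      rw [DForm.eval, ExteriorAlgebra.liftAlternating_apply_ιMulti, Pi.single_eq_same]
      exact h.apply_smul_id_mem η Y
    | zero => simp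
    | add x y _ _ hx hy =>
      rw [map_add, add_smul]
      exact add_mem hx hy
    | smul f x _ hx =>
      rw [map_smul, smul_assoc]
      exact Submodule.smul_mem _ f hx
  obtain ⟨u, hu⟩ := hη
  have h2 := Submodule.smul_mem _ (↑u⁻¹ : χ) (h1 ηs hηs)
  rw [← hu, smul_smul, Units.inv_mul, one_smul, Submodule.mem_span_set'] at h2
  obtain ⟨κ, f, T, hT⟩ := h2
  choose φ e hφ using fun i => (T i).2
  refine ⟨κ, fun i => f i • φ i, e, fun X => ?_⟩
  have := DFunLike.congr_fun hT X
  rw [LinearMap.id_apply, LinearMap.sum_apply] at this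
  rw [one_smul]
  nth_rw 1 [← this]
  refine Finset.sum_congr rfl fun i _ => ?_
  rw [hφ i]
  simp [mul_smul]

/-- Contractions are function-linear, so they inherit the annihilation by g^N. Induction on the
degree kills them all, and Euler's identity for the dual basis rebuilds (m + 1) A from them. -/
theorem HasLocalFrames.multivector_eq_zero {n : ℕ} (h : HasLocalFrames χ n) {η : DForm χ n}
    {ηs : Multivector χ} (hηs : ηs ∈ wedgeDeg χ n) (hη : IsUnit (η.eval ηs)) {m : ℕ}
    {A : Multivector χ} (hA : A ∈ wedgeDeg χ m)
    (hA0 : ∀ g : χ, IsFrameFunction n g → ∃ N : ℕ, g ^ N • A = 0) : A = 0 := by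
  obtain ⟨κ, φ, e, he⟩ := h.exists_dualBasis hηs hη
  induction m generalizing A with
  | zero =>
    obtain ⟨f, rfl⟩ : ∃ f, algebraMap χ (Multivector χ) f = A := by
      rwa [wedgeDeg, ExteriorAlgebra.exteriorPower, pow_zero, Submodule.mem_one] at hA
    rw [h f fun g hg => ?_, map_zero]
    obtain ⟨N, hN⟩ := hA0 g hg
    refine ⟨N, ?_⟩
    rwa [Algebra.smul_def, ← map_mul, ExteriorAlgebra.algebraMap_eq_zero_iff] at hN
  | succ m ih =>
    refine smul_succ_eq_zero (m := m) ?_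
    rw [← one_mul ((m + 1 : ℕ) : χ), ← sum_ι_mul_contract he hA]
    refine Finset.sum_eq_zero fun i _ => ?_
    rw [ih (contract_mem (φ i) hA) fun g hg => ?_, mul_zero]
    obtain ⟨N, hN⟩ := hA0 g hg
    exact ⟨N, by rw [← map_smul, hN, map_zero]⟩

/-- Its purpose is η⋆ ∧ X = 0. The exterior product of n + 1 fields is alternating, so it is killed
by g^(n+1) for every frame function g. -/
theorem HasLocalFrames.eq_zero_of_mem_succ {n : ℕ} (h : HasLocalFrames χ n) {η : DForm χ n}
    {ηs : Multivector χ} (hηs : ηs ∈ wedgeDeg χ n) (hη : IsUnit (η.eval ηs))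
    {A : Multivector χ} (hA : A ∈ wedgeDeg χ (n + 1)) : A = 0 := by
  rw [wedgeDeg, ← ExteriorAlgebra.ιMulti_span_fixedDegree] at hA
  induction hA using Submodule.span_induction with
  | mem x hx =>
    obtain ⟨X, rfl⟩ := hx
    exact h.multivector_eq_zero hηs hη (ιMulti_mem_wedgeDeg _ X) fun g (hg : IsFrameFunction n g) =>
      ⟨n + 1, hg.pow_smul_alternatingMap (ExteriorAlgebra.ιMulti χ (n + 1)) X⟩
  | zero => rfl
  | add x y _ _ hx hy => rw [hx, hy, add_zero]
  | smul f x _ hx => rw [hx, smul_zero]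

/-- Exterior multiplication by dg is the transpose of contraction with dg. Both obey the same
recursion when a vector field is split off on the left. -/
theorem formD_formMul_sub_apply (g : χ) (φ : FormSum χ) (A : Multivector χ) :
    (formD * formMul g - formMul g * formD : Module.End ℝ (FormSum χ)) φ A =
      φ (contract (funDifferential g) A) := by
  induction A using multivector_induction with
  | homogeneous a A hA =>
    refine wedgeDeg_induction (P := fun _ A => ∀ φ,
      (formD * formMul g - formMul g * formD : Module.End ℝ (FormSum χ)) φ A =
      φ (contract (funDifferential g) A))
      ?_ ?_ ?_ hA φ
    · intro f φ
      simp [Algebra.algebraMap_eq_smul_one]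
    · intro a X A _ ih φ
      rw [← leftContract_apply, ← Module.End.mul_apply, leftContract_mul_bracket, contract_ι_mul]
      rw [LinearMap.sub_apply, Module.End.mul_apply, FormSum.sub_apply, ih]
      simp
    · intro a A B hA hB φ
      rw [map_add, hA, hB, map_add, map_add]
  | add A B hA hB => rw [map_add, hA, hB, map_add, map_add]

/-- The constant function `1` as a form: the projection to degree zero. -/
def zeroForm : FormSum χ := FormSum.of (ExteriorAlgebra.algebraMapInv (R := χ)
  (M := VField χ)).toLinearMap

theorem zeroForm_ι_mul (X : VField χ) (A : Multivector χ) :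
    zeroForm (ExteriorAlgebra.ι χ X * A) = 0 := by
  simp [zeroForm, ExteriorAlgebra.algebraMapInv]

@[simp]
theorem zeroForm_one : zeroForm (1 : Multivector χ) = 1 := by
  simp [zeroForm]

theorem formD_zeroForm : formD (zeroForm : FormSum χ) = 0 := by
  refine FormSum.ext_ιMulti fun k v => ?_
  match k with
  | 0 => simp
  | 1 =>
    rw [formD_ιMulti]
    change v 0 (zeroForm.component 0 ![]) = 0
    simp
  | k + 2 =>
    have : (zeroForm : FormSum χ).component (k + 1) = 0 := by
      ext w
      rw [FormSum.component_apply, ExteriorAlgebra.ιMulti_succ_apply, zeroForm_ι_mul,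
        AlternatingMap.zero_apply]
    rw [formD_ιMulti, this, map_zero]
    rfl

/-- A multivector field on which all closed forms vanish is zero. -/
theorem HasLocalFrames.eq_zero_of_closed {n : ℕ} (h : HasLocalFrames χ n) {η : DForm χ n}
    {ηs : Multivector χ} (hηs : ηs ∈ wedgeDeg χ n) (hη : IsUnit (η.eval ηs)) {m : ℕ}
    {A : Multivector χ} (hA : A ∈ wedgeDeg χ m)
    (hA0 : ∀ φ : FormSum χ, formD φ = 0 → φ A = 0) : A = 0 := by
  induction m generalizing A with
  | zero =>
    obtain ⟨f, rfl⟩ : ∃ f, algebraMap χ (Multivector χ) f = A := by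
      rwa [wedgeDeg, ExteriorAlgebra.exteriorPower, pow_zero, Submodule.mem_one] at hA
    -- A function is tested on the closed form 1.
    have h1 := hA0 _ formD_zeroForm
    simpa [zeroForm] using h1
  | succ m ih =>
    -- For closed φ the form d(gφ) is exact, hence closed, and its value on A is φ evaluated on the
    -- contraction of A with dg.
    have hc : ∀ g : χ, contract (funDifferential g) A = 0 := fun g =>
      ih (contract_mem _ hA) fun φ hφ => by
        rw [← formD_formMul_sub_apply, LinearMap.sub_apply, Module.End.mul_apply,
          Module.End.mul_apply, hφ, map_zero, sub_zero]
        exact hA0 _ (DFunLike.congr_fun formD_mul_formD (formMul g φ))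
    -- Euler's identity for the local frame writes (m + 1) g A as the sum of E_k ∧ (contraction of A
    -- with dx_k), so the first power of g already suffices.
    refine h.multivector_eq_zero hηs hη hA fun g ⟨x, E, hE⟩ => ⟨1, smul_succ_eq_zero (m := m) ?_⟩
    rw [pow_one, smul_smul, mul_comm, ← sum_ι_mul_contract (φ := fun k => funDifferential (x k))
      hE hA]
    simp [hc]

end Frames

/-! ### The shuffle coproduct and the star operator. -/

section Duality

variable {χ : Type*} [CommRing χ] [Algebra ℝ χ]

theorem DForm.eval_ιMulti {k : ℕ} (γ : DForm χ k) (v : Fin k → VField χ) :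
    γ.eval (ExteriorAlgebra.ιMulti χ k v) = γ v := by
  rw [DForm.eval, ExteriorAlgebra.liftAlternating_apply_ιMulti, Pi.single_eq_same]

theorem DForm.eval_of_mem {k : ℕ} (γ : DForm χ k) {m : ℕ} (h : m ≠ k) {A : Multivector χ}
    (hA : A ∈ wedgeDeg χ m) : γ.eval A = 0 := by
  rw [wedgeDeg, ← ExteriorAlgebra.ιMulti_span_fixedDegree] at hA
  induction hA using Submodule.span_induction with
  | mem x hx =>
    obtain ⟨v, rfl⟩ := hx
    rw [DForm.eval, ExteriorAlgebra.liftAlternating_apply_ιMulti, Pi.single_eq_of_ne h]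
    rfl
  | zero => simp
  | add x y _ _ hx hy => rw [map_add, hx, hy, add_zero]
  | smul f x _ hx => rw [map_smul, hx, smul_zero]

/-- Evaluation of a form on the second factor of the graded tensor square. -/
def slant (φ : FormSum χ) : (wedgeDeg χ ᵍ⊗[χ] wedgeDeg χ) →ₗ[χ] Multivector χ :=
  (TensorProduct.rid χ (Multivector χ)).toLinearMap ∘ₗ
    LinearMap.lTensor (Multivector χ) φ.toLinearMap ∘ₗ
      (GradedTensorProduct.of χ (wedgeDeg χ) (wedgeDeg χ)).symm.toLinearMap

theorem slant_tmul (φ : FormSum χ) (u v : Multivector χ) :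
    slant φ (GradedTensorProduct.tmul χ u v) = φ v • u := by
  simp [slant, GradedTensorProduct.tmul]

theorem Multivector.inner_eq_slant (B : Multivector χ) {k : ℕ} (α : DForm χ k) :
    B.inner α = slant (FormSum.of α.eval) (coproduct B) := rfl

theorem gradedTmul_add (u v w : Multivector χ) :
    (GradedTensorProduct.tmul χ u (v + w) : wedgeDeg χ ᵍ⊗[χ] wedgeDeg χ) =
      GradedTensorProduct.tmul χ u v + GradedTensorProduct.tmul χ u w := by
  rw [GradedTensorProduct.tmul, TensorProduct.tmul_add, map_add]

theorem add_gradedTmul (u v w : Multivector χ) :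
    (GradedTensorProduct.tmul χ (u + v) w : wedgeDeg χ ᵍ⊗[χ] wedgeDeg χ) =
      GradedTensorProduct.tmul χ u w + GradedTensorProduct.tmul χ v w := by
  rw [GradedTensorProduct.tmul, TensorProduct.add_tmul, map_add]

theorem neg_gradedTmul (u v : Multivector χ) :
    (GradedTensorProduct.tmul χ (-u) v : wedgeDeg χ ᵍ⊗[χ] wedgeDeg χ) =
      -GradedTensorProduct.tmul χ u v := by
  rw [GradedTensorProduct.tmul, TensorProduct.neg_tmul, map_neg]

theorem gradedTensor_induction {P : (wedgeDeg χ ᵍ⊗[χ] wedgeDeg χ) → Prop}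
    (tmul : ∀ i j, ∀ u ∈ wedgeDeg χ i, ∀ v ∈ wedgeDeg χ j, P (GradedTensorProduct.tmul χ u v))
    (add : ∀ s t, P s → P t → P (s + t)) (t : wedgeDeg χ ᵍ⊗[χ] wedgeDeg χ) : P t := by
  obtain ⟨t, rfl⟩ := (GradedTensorProduct.of χ (wedgeDeg χ) (wedgeDeg χ)).surjective t
  induction t using TensorProduct.induction_on with
  | zero =>
    have := tmul 0 0 0 (zero_mem _) 0 (zero_mem _)
    rwa [GradedTensorProduct.tmul, TensorProduct.tmul_zero] at this
  | tmul u v =>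
    change P (GradedTensorProduct.tmul χ u v)
    induction u using multivector_induction with
    | homogeneous i u hu =>
      induction v using multivector_induction with
      | homogeneous j v hv => exact tmul i j u hu v hv
      | add v w hv hw =>
        rw [gradedTmul_add]
        exact add _ _ hv hw
    | add u w hu hw =>
      rw [add_gradedTmul]
      exact add _ _ hu hw
  | add s t hs ht =>
    rw [map_add]
    exact add _ _ hs ht

theorem coproduct_ι (X : VField χ) :
    coproduct (ExteriorAlgebra.ι χ X) = GradedTensorProduct.tmul χ (ExteriorAlgebra.ι χ X) 1 +
      GradedTensorProduct.tmul χ 1 (ExteriorAlgebra.ι χ X) := by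
  rw [coproduct, ExteriorAlgebra.lift_ι_apply]
  rfl

theorem slant_ι_one_mul (φ : FormSum χ) (X : VField χ) (t : wedgeDeg χ ᵍ⊗[χ] wedgeDeg χ) :
    slant φ (GradedTensorProduct.tmul χ (ExteriorAlgebra.ι χ X) 1 * t) =
      ExteriorAlgebra.ι χ X * slant φ t := by
  induction t using gradedTensor_induction with
  | tmul i j u hu v hv =>
    rw [GradedTensorProduct.tmul_one_mul_coe_tmul (wedgeDeg χ) (wedgeDeg χ) _ ⟨u, hu⟩ v, slant_tmul,
      slant_tmul, mul_smul_comm]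
  | add s t hs ht => rw [mul_add, map_add, map_add, hs, ht, mul_add]

/-- The Koszul sign for moving X past the left factor is the grade involution of the result. -/
theorem slant_one_ι_mul (φ : FormSum χ) (X : VField χ) (t : wedgeDeg χ ᵍ⊗[χ] wedgeDeg χ) :
    slant φ (GradedTensorProduct.tmul χ 1 (ExteriorAlgebra.ι χ X) * t) =
      CliffordAlgebra.involute (slant (leftContract X φ) t) := by
  induction t using gradedTensor_induction with
  | tmul i j u hu v hv =>
    rw [GradedTensorProduct.tmul_coe_mul_coe_tmul (wedgeDeg χ) (wedgeDeg χ) 1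
      ⟨_, ι_mem_wedgeDeg_one X⟩ ⟨u, hu⟩ v, map_intUnits_smul, slant_tmul, slant_tmul, map_smul,
      involute_of_mem hu, leftContract_apply, smul_comm, one_mul, one_mul]
  | add s t hs ht => rw [mul_add, map_add, map_add, hs, ht, map_add]

theorem slant_mul_one_ι (φ : FormSum χ) (X : VField χ) (t : wedgeDeg χ ᵍ⊗[χ] wedgeDeg χ) :
    slant φ (t * GradedTensorProduct.tmul χ 1 (ExteriorAlgebra.ι χ X)) =
      slant (rightAction (ExteriorAlgebra.ι χ X) φ) t := by
  induction t using gradedTensor_induction with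
  | tmul i j u hu v hv =>
    rw [GradedTensorProduct.tmul_coe_mul_one_tmul (wedgeDeg χ) (wedgeDeg χ) u ⟨v, hv⟩, slant_tmul,
      slant_tmul, rightAction_apply]
  | add s t hs ht => rw [add_mul, map_add, map_add, hs, ht]

theorem coproduct_mul_ι_one {p : ℕ} {A : Multivector χ} (hA : A ∈ wedgeDeg χ p) (X : VField χ) :
    coproduct A * GradedTensorProduct.tmul χ (ExteriorAlgebra.ι χ X) 1 =
      (-1 : ℤˣ) ^ p • (GradedTensorProduct.tmul χ (ExteriorAlgebra.ι χ X) 1 * coproduct A) := by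
  refine wedgeDeg_induction (P := fun p A =>
    coproduct A * GradedTensorProduct.tmul χ (ExteriorAlgebra.ι χ X) 1 =
      (-1 : ℤˣ) ^ p • (GradedTensorProduct.tmul χ (ExteriorAlgebra.ι χ X) 1 * coproduct A))
    ?_ ?_ ?_ hA
  · intro f
    rw [AlgHom.commutes, Algebra.commutes, pow_zero, one_smul]
  · intro p Y A _ ih
    have h1 := GradedTensorProduct.tmul_coe_mul_coe_tmul (R := χ) (wedgeDeg χ) (wedgeDeg χ)
        1 ⟨_, ι_mem_wedgeDeg_one Y⟩ ⟨_, ι_mem_wedgeDeg_one X⟩ 1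
    have h2 := GradedTensorProduct.tmul_one_mul_one_tmul (R := χ) (wedgeDeg χ) (wedgeDeg χ)
        (ExteriorAlgebra.ι χ X) (ExteriorAlgebra.ι χ Y)
    have h3 := GradedTensorProduct.tmul_one_mul_coe_tmul (R := χ) (wedgeDeg χ) (wedgeDeg χ)
        (ExteriorAlgebra.ι χ X) ⟨_, ι_mem_wedgeDeg_one Y⟩ 1
    have h4 := GradedTensorProduct.tmul_one_mul_coe_tmul (R := χ) (wedgeDeg χ) (wedgeDeg χ)
        (ExteriorAlgebra.ι χ Y) ⟨_, ι_mem_wedgeDeg_one X⟩ 1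
    simp only [one_mul, mul_one, uzpow_one, Units.neg_smul, one_smul] at h1
    have h5 : coproduct (ExteriorAlgebra.ι χ Y) *
        GradedTensorProduct.tmul χ (ExteriorAlgebra.ι χ X) 1 =
        -(GradedTensorProduct.tmul χ (ExteriorAlgebra.ι χ X) 1 *
          coproduct (ExteriorAlgebra.ι χ Y)) := by
      rw [coproduct_ι, add_mul, mul_add, h1, h2, h3, h4,
        eq_neg_of_add_eq_zero_left (ExteriorAlgebra.ι_add_mul_swap Y X)]
      rw [neg_gradedTmul]
      abel
    rw [map_mul, mul_assoc, ih, mul_smul_comm, ← mul_assoc, h5, pow_succ, mul_smul, ← mul_assoc,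
      neg_mul]
    simp
  · intro p A B hA hB
    rw [map_add, add_mul, hA, hB, mul_add, smul_add]

theorem slant_coproduct_ι_mul (φ : FormSum χ) (X : VField χ) (A : Multivector χ) :
    slant φ (coproduct (ExteriorAlgebra.ι χ X * A)) =
      ExteriorAlgebra.ι χ X * slant φ (coproduct A) +
        CliffordAlgebra.involute (slant (leftContract X φ) (coproduct A)) := by
  rw [map_mul, coproduct_ι, add_mul, map_add, slant_ι_one_mul, slant_one_ι_mul]

theorem slant_coproduct_algebraMap (φ : FormSum χ) (f : χ) :
    slant φ (coproduct (algebraMap χ (Multivector χ) f)) = algebraMap χ _ (f * φ 1) := by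
  rw [AlgHom.commutes, GradedTensorProduct.algebraMap_def, slant_tmul]
  rw [← map_one (algebraMap χ (Multivector χ)), Algebra.smul_def, ← map_mul, mul_comm]

theorem slant_formMul (f : χ) (φ : FormSum χ) (t : wedgeDeg χ ᵍ⊗[χ] wedgeDeg χ) :
    slant (formMul f φ) t = f • slant φ t := by
  induction t using gradedTensor_induction with
  | tmul i j u hu v hv => rw [slant_tmul, slant_tmul, formMul_apply, mul_smul]
  | add s t hs ht => rw [map_add, map_add, hs, ht, smul_add]

theorem slant_add (φ ψ : FormSum χ) (t : wedgeDeg χ ᵍ⊗[χ] wedgeDeg χ) :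
    slant (φ + ψ) t = slant φ t + slant ψ t := by
  induction t using gradedTensor_induction with
  | tmul i j u hu v hv => rw [slant_tmul, slant_tmul, slant_tmul, FormSum.add_apply, add_smul]
  | add s t hs ht =>
    rw [map_add, map_add, map_add, hs, ht]
    abel

theorem slant_zero : slant (0 : FormSum χ) = 0 := by
  ext
  simp [slant_tmul]

theorem zeroForm_of_mem_succ {a : ℕ} {A : Multivector χ} (hA : A ∈ wedgeDeg χ (a + 1)) :
    zeroForm A = 0 := by
  refine wedgeDeg_induction (P := fun a A => a ≠ 0 → zeroForm A = 0) ?_ ?_ ?_ hA (by omega)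
  · intro f h
    exact absurd rfl h
  · intro a X A _ _ _
    exact zeroForm_ι_mul X A
  · intro a A B hA hB h
    rw [map_add, hA h, hB h, add_zero]

theorem slant_zeroForm (A : Multivector χ) : slant zeroForm (coproduct A) = A := by
  induction A using multivector_induction with
  | homogeneous a A hA =>
    refine wedgeDeg_induction (P := fun _ A => slant zeroForm (coproduct A) = A) ?_ ?_ ?_ hA
    · intro f
      rw [slant_coproduct_algebraMap, zeroForm_one, mul_one]
    · intro a X A _ ih
      have h : leftContract X (zeroForm : FormSum χ) = 0 :=
        FormSum.ext fun B => zeroForm_ι_mul X B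
      rw [slant_coproduct_ι_mul, ih, h, slant_zero]
      simp
    · intro a A B hA hB
      rw [map_add, map_add, hA, hB]
  | add A B hA hB => rw [map_add, map_add, hA, hB]

/-- Only the term 1 ⊗ A of the coproduct has a right factor of degree at least p. -/
theorem slant_coproduct_top {p : ℕ} {A : Multivector χ} (hA : A ∈ wedgeDeg χ p) {φ : FormSum χ}
    (hφ : ∀ j < p, ∀ B ∈ wedgeDeg χ j, φ B = 0) :
    slant φ (coproduct A) = algebraMap χ _ (φ A) := by
  refine wedgeDeg_induction (P := fun p A => ∀ φ : FormSum χ,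
    (∀ j < p, ∀ B ∈ wedgeDeg χ j, φ B = 0) → slant φ (coproduct A) = algebraMap χ _ (φ A))
    ?_ ?_ ?_ hA φ hφ
  · intro f φ _
    rw [slant_coproduct_algebraMap, Algebra.algebraMap_eq_smul_one (A := Multivector χ) f,
      map_smul, smul_eq_mul]
  · intro a X A hA ih φ hφ
    rw [slant_coproduct_ι_mul, ih φ fun j hj => hφ j (by omega),
      hφ a (by omega) A hA, ih (leftContract X φ) fun j hj B hB => ?_]
    · simp
    · rw [leftContract_apply, hφ (j + 1) (by omega)]
      rw [add_comm]
      exact mul_mem_wedgeDeg (ι_mem_wedgeDeg_one X) hB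
  · intro a A B hA hB φ hφ
    rw [map_add, map_add, hA φ hφ, hB φ hφ, map_add, map_add]

/-- Contraction of a top degree field is linear over the exterior algebra, up to sign. -/
theorem slant_rightAction {n : ℕ} {ηs : Multivector χ} (hηs : ηs ∈ wedgeDeg χ n)
    (h0 : ∀ X : VField χ, ηs * ExteriorAlgebra.ι χ X = 0) {a : ℕ} {A : Multivector χ}
    (hA : A ∈ wedgeDeg χ a) (φ : FormSum χ) :
    slant (rightAction A φ) (coproduct ηs) =
      (-1 : ℤˣ) ^ ((n + 1) * a) • (A * slant φ (coproduct ηs)) := by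
  refine wedgeDeg_induction (P := fun a A => slant (rightAction A φ) (coproduct ηs) =
      (-1 : ℤˣ) ^ ((n + 1) * a) • (A * slant φ (coproduct ηs))) ?_ ?_ ?_ hA
  · intro f
    rw [rightAction_algebraMap, slant_formMul, mul_zero, pow_zero, one_smul, Algebra.smul_def]
  · intro a X A _ ih
    -- As η⋆ ∧ X = 0, the coproduct of η⋆ is annihilated by X ⊗ 1 + 1 ⊗ X. This trades a factor X
    -- acting on the form for a factor X outside the contraction.
    have h1 := congrArg (fun B => slant (rightAction A φ) (coproduct B)) (h0 X)
    simp only [map_mul, coproduct_ι, mul_add, map_add, slant_mul_one_ι, coproduct_mul_ι_one hηs,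
      map_intUnits_smul, slant_ι_one_mul, map_zero, ih] at h1
    rw [map_mul, Module.End.mul_apply, eq_neg_of_add_eq_zero_right h1, mul_smul_comm, smul_smul,
      mul_add (n + 1) a, pow_add _ ((n + 1) * a), mul_one, pow_succ _ n, ← mul_assoc,
      mul_comm ((-1) ^ n)]
    simp
  · intro a A B hA hB
    rw [map_add, LinearMap.add_apply, slant_add, hA, hB, add_mul A, smul_add]

theorem slant_coproduct_eq_zero {k p : ℕ} (hp : p < k) {A : Multivector χ} (hA : A ∈ wedgeDeg χ p)
    {φ : FormSum χ} (hφ : ∀ j, j ≠ k → ∀ B ∈ wedgeDeg χ j, φ B = 0) :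
    slant φ (coproduct A) = 0 := by
  rw [slant_coproduct_top hA fun j hj => hφ j (by omega), hφ p hp.ne A hA, map_zero]

theorem slant_coproduct_mem {k q p : ℕ} (hp : p = q + k) {A : Multivector χ}
    (hA : A ∈ wedgeDeg χ p) {φ : FormSum χ}
    (hφ : ∀ j, j ≠ k → ∀ B ∈ wedgeDeg χ j, φ B = 0) :
    slant φ (coproduct A) ∈ wedgeDeg χ q := by
  refine wedgeDeg_induction (P := fun p A => ∀ (q k : ℕ) (φ : FormSum χ),
    (∀ j, j ≠ k → ∀ B ∈ wedgeDeg χ j, φ B = 0) → p = q + k →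
    slant φ (coproduct A) ∈ wedgeDeg χ q) ?_ ?_ ?_ hA q k φ hφ hp
  · intro f q k φ _ h
    obtain rfl : q = 0 := by omega
    rw [slant_coproduct_algebraMap]
    exact algebraMap_mem_wedgeDeg _
  · intro a X A hA ih q k φ hφ h
    rw [slant_coproduct_ι_mul]
    refine add_mem ?_ ?_
    · cases q with
      | zero => simp [slant_coproduct_eq_zero (show a < k by omega) hA hφ]
      | succ q =>
        rw [add_comm q 1]
        exact mul_mem_wedgeDeg (ι_mem_wedgeDeg_one X) (ih q k φ hφ (by omega))
    · cases k with
      | zero =>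
        have : leftContract X φ = 0 := FormSum.ext_homogeneous fun k B hB => by
          rw [leftContract_apply, hφ (1 + k) (by omega) _
            (mul_mem_wedgeDeg (ι_mem_wedgeDeg_one X) hB), FormSum.zero_apply]
        rw [this, slant_zero]
        simp
      | succ k =>
        have := ih q k (leftContract X φ) (fun j hj B hB => by
          rw [leftContract_apply, hφ (1 + j) (by omega) _
            (mul_mem_wedgeDeg (ι_mem_wedgeDeg_one X) hB)]) (by omega)
        rw [involute_of_mem this]
        rcases neg_one_pow_eq_or ℤˣ q with hq | hq <;> simpa [hq] using this
  · intro a A B hA hB q k φ hφ h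
    rw [map_add, map_add]
    exact add_mem (hA q k φ hφ h) (hB q k φ hφ h)

/-- The dual `∗ A = (η, A)` of a multivector field, as an inhomogeneous form. -/
def hodgeStar {n : ℕ} (η : DForm χ n) : Multivector χ →ₗ[ℝ] FormSum χ where
  toFun A := rightAction A (FormSum.of η.eval)
  map_add' A B := by rw [map_add, LinearMap.add_apply]
  map_smul' c A := by
    refine FormSum.ext fun B => ?_
    simp [rightAction_apply]

@[simp]
theorem hodgeStar_apply {n : ℕ} (η : DForm χ n) (A B : Multivector χ) :
    hodgeStar η A B = η.eval (B * A) := rfl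

theorem hodgeStar_mul {n : ℕ} (η : DForm χ n) (A B : Multivector χ) :
    hodgeStar η (A * B) = rightAction A (hodgeStar η B) :=
  FormSum.ext fun C => by simp [mul_assoc]

theorem hodgeStar_component {n : ℕ} (η : DForm χ n) (A : Multivector χ) (k : ℕ) :
    (hodgeStar η A).component k = η.inner k A := rfl

/-- This is ∗∗A = ±A: apply `slant_rightAction` to the form η, whose contraction with η⋆ is the
scalar ε. -/
theorem slant_hodgeStar {n : ℕ} {ε : ℤˣ} {η : DForm χ n} {ηs : Multivector χ}
    (hηs : ηs ∈ wedgeDeg χ n) (hη : η.eval ηs = ((ε : ℤ) : χ))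
    (h0 : ∀ X : VField χ, ηs * ExteriorAlgebra.ι χ X = 0) {a : ℕ} {A : Multivector χ}
    (hA : A ∈ wedgeDeg χ a) :
    slant (hodgeStar η A) (coproduct ηs) = (-1 : ℤˣ) ^ ((n + 1) * a) • ε • A := by
  have h := slant_rightAction hηs h0 hA (FormSum.of η.eval)
  rw [slant_coproduct_top (φ := FormSum.of η.eval) hηs fun j hj B hB => η.eval_of_mem hj.ne hB,
    FormSum.of_apply, hη,
    ← Algebra.commutes, ← Algebra.smul_def] at h
  refine h.trans ?_
  rcases Int.units_eq_one_or ε with rfl | rfl <;> simp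

theorem hodgeStar_injective {n : ℕ} {ε : ℤˣ} {η : DForm χ n} {ηs : Multivector χ}
    (hηs : ηs ∈ wedgeDeg χ n) (hη : η.eval ηs = ((ε : ℤ) : χ))
    (h0 : ∀ X : VField χ, ηs * ExteriorAlgebra.ι χ X = 0) : Function.Injective (hodgeStar η) := by
  -- The sign (-1)^((n+1)a) depends on the degree. On inhomogeneous fields it is the identity or the
  -- grade involution, according to the parity of n + 1.
  have h : (∀ A, slant (hodgeStar η A) (coproduct ηs) = ε • A) ∨
      ∀ A, slant (hodgeStar η A) (coproduct ηs) = ε • CliffordAlgebra.involute A := by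
    rcases neg_one_pow_eq_or ℤˣ (n + 1) with hn | hn
    · left
      intro A
      induction A using multivector_induction with
      | homogeneous a A hA =>
        rw [slant_hodgeStar hηs hη h0 hA, pow_mul, hn, one_pow, one_smul]
      | add A B hA hB => rw [map_add, slant_add, hA, hB, smul_add]
    · right
      intro A
      induction A using multivector_induction with
      | homogeneous a A hA =>
        rw [slant_hodgeStar hηs hη h0 hA, pow_mul, hn, involute_of_mem hA, smul_comm]
      | add A B hA hB => rw [map_add, slant_add, hA, hB, map_add, smul_add]
  intro A B hAB
  rcases h with h | h
  · exact smul_left_cancel ε (by rw [← h, ← h, hAB])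
  · exact CliffordAlgebra.involute_involutive.injective
      (smul_left_cancel ε (by rw [← h, ← h, hAB]))

/-- This is ∗∗α = ±α. On a field B of degree k, contracting α with B leaves the function α(B), so
`slant_rightAction` reads α(B) η⋆ = ± B ∧ (η⋆, α); applying η gives the value. In other degrees both
sides vanish. -/
theorem hodgeStar_inner {n : ℕ} {ε : ℤˣ} {η : DForm χ n} {ηs : Multivector χ}
    (hηs : ηs ∈ wedgeDeg χ n) (hη : η.eval ηs = ((ε : ℤ) : χ))
    (h0 : ∀ X : VField χ, ηs * ExteriorAlgebra.ι χ X = 0) {k : ℕ} (α : DForm χ k) :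
    hodgeStar η (ηs.inner α) = (-1 : ℤˣ) ^ ((n + 1) * k) • ε • FormSum.of α.eval := by
  refine FormSum.ext_homogeneous fun j B hB => ?_
  rw [hodgeStar_apply, Multivector.inner_eq_slant, FormSum.units_smul_apply,
    FormSum.units_smul_apply,
    FormSum.of_apply]
  by_cases hj : j = k
  · subst hj
    have h1 : rightAction B (FormSum.of α.eval) = formMul (α.eval B) zeroForm := by
      refine FormSum.ext_homogeneous fun i C hC => ?_
      rw [rightAction_apply, formMul_apply, FormSum.of_apply]
      cases i with
      | zero =>
        rw [wedgeDeg, ExteriorAlgebra.exteriorPower, pow_zero, Submodule.mem_one] at hC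
        obtain ⟨f, rfl⟩ := hC
        rw [← Algebra.smul_def, map_smul]
        simp [zeroForm, mul_comm]
      | succ i =>
        rw [α.eval_of_mem (by omega) (mul_mem_wedgeDeg hC hB), zeroForm_of_mem_succ hC, mul_zero]
    have h2 := slant_rightAction hηs h0 hB (FormSum.of α.eval)
    rw [h1, slant_formMul, slant_zeroForm] at h2
    have h3 := congrArg η.eval h2
    rw [map_smul, hη, map_intUnits_smul] at h3
    have h4 := congrArg (fun f => (-1 : ℤˣ) ^ ((n + 1) * j) • f) h3
    simp only [smul_smul, ← mul_pow, neg_one_mul, neg_neg, one_pow, one_smul] at h4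
    rw [← h4]
    rcases Int.units_eq_one_or ε with rfl | rfl <;> simp
  · rw [α.eval_of_mem hj hB, smul_zero, smul_zero]
    by_cases hk : n < k
    · rw [slant_coproduct_eq_zero (φ := FormSum.of α.eval) hk hηs
        fun i hi C hC => α.eval_of_mem hi hC, mul_zero, map_zero]
    · have h1 := slant_coproduct_mem (q := n - k) (by omega) hηs
        fun i hi C hC => (α.eval_of_mem hi hC : FormSum.of α.eval C = 0)
      exact η.eval_of_mem (by omega) (mul_mem_wedgeDeg hB h1)

theorem DForm.inner_of_mem {n : ℕ} (η : DForm χ n) {k a : ℕ} (h : k + a ≠ n) {A : Multivector χ}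
    (hA : A ∈ wedgeDeg χ a) : η.inner k A = 0 := by
  ext v
  exact η.eval_of_mem h (mul_mem_wedgeDeg (ιMulti_mem_wedgeDeg k v) hA)

theorem DForm.inner_of_lt {n : ℕ} (η : DForm χ n) {k : ℕ} (h : n < k) (A : Multivector χ) :
    η.inner k A = 0 := by
  induction A using multivector_induction with
  | homogeneous a A hA => exact η.inner_of_mem (by omega) hA
  | add A B hA hB => rw [map_add, hA, hB, add_zero]

theorem codifferential_apply {n : ℕ} (ε : ℤˣ) (η : DForm χ n) (ηs A : Multivector χ) :
    codifferential ε η ηs A = ∑ k ∈ Finset.range (n + 1),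
      (ε * (-1) ^ (n * (n - k))) • ηs.inner (extD (η.inner k A)) := by
  rw [codifferential, LinearMap.sum_apply]
  rfl

theorem codifferential_mem {n : ℕ} (ε : ℤˣ) (η : DForm χ n) {ηs : Multivector χ}
    (hηs : ηs ∈ wedgeDeg χ n) {a : ℕ} {A : Multivector χ} (hA : A ∈ wedgeDeg χ (a + 1)) :
    codifferential ε η ηs A ∈ wedgeDeg χ a := by
  rw [codifferential_apply]
  refine Submodule.sum_mem _ fun k hk => ?_
  by_cases h : k + (a + 1) = n
  · have := slant_coproduct_mem (k := k + 1) (q := a) (by omega) hηs (φ := FormSum.of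
      (extD (η.inner k A)).eval) fun i hi C hC => DForm.eval_of_mem _ hi hC
    rw [Multivector.inner_eq_slant]
    rcases Int.units_eq_one_or (ε * (-1) ^ (n * (n - k))) with h | h <;> rw [h] <;> simpa
  · rw [η.inner_of_mem h hA, map_zero, map_zero, smul_zero]
    exact zero_mem _

theorem codifferential_of_mem_zero {n : ℕ} (ε : ℤˣ) (η : DForm χ n) {ηs : Multivector χ}
    (hηs : ηs ∈ wedgeDeg χ n) {A : Multivector χ} (hA : A ∈ wedgeDeg χ 0) :
    codifferential ε η ηs A = 0 := by
  rw [codifferential_apply]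
  refine Finset.sum_eq_zero fun k hk => ?_
  by_cases h : k + 0 = n
  -- Here d∗A has degree n + 1, too large to be contracted into an n-vector field.
  · rw [Multivector.inner_eq_slant, slant_coproduct_eq_zero
      (φ := FormSum.of (extD (η.inner k A)).eval) (show n < k + 1 by omega) hηs
        fun i hi C hC => DForm.eval_of_mem _ hi hC, smul_zero]
  · rw [η.inner_of_mem h hA, map_zero, map_zero, smul_zero]

/-- On the component of degree k of ∗A, the sign in δ and the sign of ∗∗ multiply to (-1)^(k+1), the
grade involution on the (k+1)-form d∗A. -/
theorem hodgeStar_codifferential {n : ℕ} {ε : ℤˣ} {η : DForm χ n} {ηs : Multivector χ}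
    (hηs : ηs ∈ wedgeDeg χ n) (hη : η.eval ηs = ((ε : ℤ) : χ))
    (h0 : ∀ X : VField χ, ηs * ExteriorAlgebra.ι χ X = 0) (A : Multivector χ) :
    hodgeStar η (codifferential ε η ηs A) = formDelta (hodgeStar η A) := by
  have h1 : ∀ k ∈ Finset.range (n + 1),
      hodgeStar η ((ε * (-1) ^ (n * (n - k))) • ηs.inner (extD (η.inner k A))) =
      (-1 : ℤˣ) ^ (k + 1) • FormSum.of (extD (η.inner k A)).eval := by
    intro k hk
    rw [map_intUnits_smul, hodgeStar_inner hηs hη h0, smul_smul, smul_smul]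
    congr 1
    obtain ⟨j, rfl⟩ : ∃ j, n = k + j := ⟨n - k, by simp at hk; omega⟩
    rw [Nat.add_sub_cancel_left]
    rcases Int.units_eq_one_or ε with rfl | rfl <;>
      rcases neg_one_pow_eq_or ℤˣ k with hk | hk <;>
      rcases neg_one_pow_eq_or ℤˣ j with hj | hj <;>
      simp [add_mul, mul_add, pow_add, pow_mul, hk, hj]
  rw [codifferential_apply, map_sum, Finset.sum_congr rfl h1]
  refine FormSum.ext_ιMulti fun m v => ?_
  have h2 : formDelta (hodgeStar η A) (ExteriorAlgebra.ιMulti χ m v) =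
      (-1 : ℤˣ) ^ m • formD (hodgeStar η A) (ExteriorAlgebra.ιMulti χ m v) := by
    rw [formDelta, Module.End.mul_apply, formInvolute_apply, involute_ιMulti, map_intUnits_smul]
  have h3 : ∀ k, FormSum.of (extD (η.inner k A)).eval (ExteriorAlgebra.ιMulti χ m v) =
      if k + 1 = m then formD (hodgeStar η A) (ExteriorAlgebra.ιMulti χ m v) else 0 := by
    intro k
    split_ifs with h
    · subst h
      rw [formD_ιMulti, hodgeStar_component, FormSum.of_apply, DForm.eval_ιMulti]
    · exact DForm.eval_of_mem _ (Ne.symm h) (ιMulti_mem_wedgeDeg m v)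
  rw [h2]
  have h4 : ∀ s : Finset ℕ, (∑ k ∈ s, (-1 : ℤˣ) ^ (k + 1) •
      FormSum.of (extD (η.inner k A)).eval) (ExteriorAlgebra.ιMulti χ m v) =
      ∑ k ∈ s, if k + 1 = m then
        (-1 : ℤˣ) ^ m • formD (hodgeStar η A) (ExteriorAlgebra.ιMulti χ m v) else 0 := by
    intro s
    induction s using Finset.induction_on with
    | empty => rfl
    | insert k s hk ih =>
      rw [Finset.sum_insert hk, Finset.sum_insert hk, FormSum.add_apply, ih,
        FormSum.units_smul_apply, h3]
      split_ifs with h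
      · rw [h]
      · rw [smul_zero]
  rw [h4]
  cases m with
  | zero => simp
  | succ m =>
    simp only [Nat.add_right_cancel_iff, Finset.sum_ite_eq', Finset.mem_range]
    -- The sum stops at k = n; beyond it ∗A has no components.
    split_ifs with h
    · rfl
    · rw [formD_ιMulti, hodgeStar_component, η.inner_of_lt (by omega), map_zero,
        AlternatingMap.zero_apply, smul_zero]

end Duality

/-! ### Batalin–Vilkovisky operators and the Jacobi identity of their brackets. -/

section BVOperator

variable {χ : Type*} [CommRing χ] [Algebra ℝ χ]

/-- The bracket `{A, B} = (-1)^a A ∧ δB + δA ∧ B - δ(A ∧ B)` of an operator. -/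
def schoutenBracket (δ : Multivector χ →ₗ[ℝ] Multivector χ) :
    Multivector χ →ₗ[ℝ] Multivector χ →ₗ[ℝ] Multivector χ :=
  leibnizBracket δ ∘ₗ
    (CliffordAlgebra.involute : Multivector χ →ₐ[χ] Multivector χ).toLinearMap.restrictScalars ℝ

theorem schoutenBracket_apply (δ : Multivector χ →ₗ[ℝ] Multivector χ) {a : ℕ}
    {A : Multivector χ} (hA : A ∈ wedgeDeg χ a) (B : Multivector χ) :
    schoutenBracket δ A B = (-1 : ℤˣ) ^ a • (A * δ B) + δ A * B - δ (A * B) := by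
  have : schoutenBracket δ A B = leibnizBracket δ (CliffordAlgebra.involute A) B := rfl
  rw [this, involute_of_mem hA, map_intUnits_smul, LinearMap.smul_apply,
    leibnizBracket_apply_of_mem δ hA, smul_add, smul_smul, ← mul_pow, neg_one_mul, neg_neg, one_pow,
    one_smul, add_sub_assoc]

/-- Square zero operators of degree `-1` and second order on the exterior algebra. -/
structure IsBVOperator (δ : Multivector χ →ₗ[ℝ] Multivector χ) : Prop where
  map_zero : ∀ A ∈ wedgeDeg χ 0, δ A = 0
  map_mem : ∀ a, ∀ A ∈ wedgeDeg χ (a + 1), δ A ∈ wedgeDeg χ a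
  sq_zero : ∀ A, δ (δ A) = 0
  bracket_mul : ∀ a b, ∀ A ∈ wedgeDeg χ a, ∀ B ∈ wedgeDeg χ b, ∀ C,
    schoutenBracket δ A (B * C) =
      schoutenBracket δ A B * C + (-1 : ℤˣ) ^ ((a + 1) * b) • (B * schoutenBracket δ A C)

namespace IsBVOperator

variable {δ : Multivector χ →ₗ[ℝ] Multivector χ} (h : IsBVOperator δ)

include h

/-- A stand-in for degree a - 1. Signs see only parity, and in degree 0 the image is zero, which
lies in degree 1. -/
theorem exists_map_mem {a : ℕ} {A : Multivector χ} (hA : A ∈ wedgeDeg χ a) :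
    ∃ m, (-1 : ℤˣ) ^ m = (-1) ^ (a + 1) ∧ δ A ∈ wedgeDeg χ m := by
  cases a with
  | zero => exact ⟨1, rfl, by rw [h.map_zero A hA]; exact zero_mem _⟩
  | succ a => exact ⟨a, by simp [pow_add], h.map_mem a A hA⟩

theorem map_mul_comm {a b : ℕ} {A B : Multivector χ} (hA : A ∈ wedgeDeg χ a)
    (hB : B ∈ wedgeDeg χ b) : δ A * B = (-1 : ℤˣ) ^ ((a + 1) * b) • (B * δ A) := by
  obtain ⟨m, hm, h1⟩ := h.exists_map_mem hA
  rw [wedge_comm h1 hB, pow_mul, hm, pow_mul]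

theorem bracket_mem {a b m : ℕ} (hm : m + 1 = a + b) {A B : Multivector χ}
    (hA : A ∈ wedgeDeg χ a) (hB : B ∈ wedgeDeg χ b) : schoutenBracket δ A B ∈ wedgeDeg χ m := by
  rw [schoutenBracket_apply δ hA]
  have h1 : A * δ B ∈ wedgeDeg χ m := by
    cases b with
    | zero => rw [h.map_zero B hB, mul_zero]; exact zero_mem _
    | succ b =>
      obtain rfl : m = a + b := by omega
      exact mul_mem_wedgeDeg hA (h.map_mem b B hB)
  have h2 : δ A * B ∈ wedgeDeg χ m := by
    cases a with
    | zero => rw [h.map_zero A hA, zero_mul]; exact zero_mem _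
    | succ a =>
      obtain rfl : m = a + b := by omega
      exact mul_mem_wedgeDeg (h.map_mem a A hA) hB
  have h3 : δ (A * B) ∈ wedgeDeg χ m := h.map_mem m _ (hm ▸ mul_mem_wedgeDeg hA hB)
  refine sub_mem (add_mem ?_ h2) h3
  rcases neg_one_pow_eq_or ℤˣ a with ha | ha <;> simpa [ha] using h1

theorem bracket_of_zero {A B : Multivector χ} (hA : A ∈ wedgeDeg χ 0) (hB : B ∈ wedgeDeg χ 0) :
    schoutenBracket δ A B = 0 := by
  rw [schoutenBracket_apply δ hA, h.map_zero A hA, h.map_zero B hB,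
    h.map_zero _ (mul_mem_wedgeDeg hA hB)]
  simp

theorem exists_bracket_mem {a b : ℕ} {A B : Multivector χ}
    (hA : A ∈ wedgeDeg χ a) (hB : B ∈ wedgeDeg χ b) :
    ∃ m, (-1 : ℤˣ) ^ m = (-1) ^ (a + b + 1) ∧ schoutenBracket δ A B ∈ wedgeDeg χ m := by
  by_cases h0 : a + b = 0
  · obtain ⟨rfl, rfl⟩ : a = 0 ∧ b = 0 := by omega
    exact ⟨1, rfl, by rw [h.bracket_of_zero hA hB]; exact zero_mem _⟩
  · exact ⟨a + b - 1, by
      obtain ⟨m, hm⟩ := Nat.exists_eq_succ_of_ne_zero h0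
      simp [hm, pow_succ], h.bracket_mem (by omega) hA hB⟩

theorem bracket_symm {a b : ℕ} {A B : Multivector χ}
    (hA : A ∈ wedgeDeg χ a) (hB : B ∈ wedgeDeg χ b) :
    schoutenBracket δ A B = (-1 : ℤˣ) ^ (a * b) • schoutenBracket δ B A := by
  rw [schoutenBracket_apply δ hA, schoutenBracket_apply δ hB, h.map_mul_comm hA hB,
    h.map_mul_comm hB hA, wedge_comm hA hB, map_intUnits_smul, smul_sub, smul_add, smul_smul,
    smul_smul]
  rcases neg_one_pow_eq_or ℤˣ a with ha | ha <;> rcases neg_one_pow_eq_or ℤˣ b with hb | hb <;>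
    simp [add_mul, pow_add, pow_mul, ha, hb] <;> abel

/-- The operator is an antiderivation of its bracket. -/
theorem map_bracket {a : ℕ} {A : Multivector χ} (hA : A ∈ wedgeDeg χ a) (B : Multivector χ) :
    schoutenBracket δ A (δ B) =
      -((-1 : ℤˣ) ^ a • (δ (schoutenBracket δ A B) + schoutenBracket δ (δ A) B)) := by
  obtain ⟨m, hm, h1⟩ := h.exists_map_mem hA
  rw [schoutenBracket_apply δ hA, schoutenBracket_apply δ hA, schoutenBracket_apply δ h1, hm,
    map_sub, map_add, h.sq_zero, h.sq_zero, h.sq_zero, map_intUnits_smul]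
  rcases neg_one_pow_eq_or ℤˣ a with ha | ha <;> simp [pow_add, ha] <;> abel

/-- Expand the inner bracket {B, C} into products and δ. The adjoint of A is a derivation of the
product by `bracket_mul` and passes through δ by `map_bracket`; collecting terms gives the Leibniz
form of the Jacobi identity. -/
theorem bracket_bracket {a b : ℕ} {A B : Multivector χ}
    (hA : A ∈ wedgeDeg χ a) (hB : B ∈ wedgeDeg χ b) (C : Multivector χ) :
    schoutenBracket δ A (schoutenBracket δ B C) =
      -((-1 : ℤˣ) ^ a • schoutenBracket δ (schoutenBracket δ A B) C) +
        (-1 : ℤˣ) ^ ((a + 1) * (b + 1)) • schoutenBracket δ B (schoutenBracket δ A C) := by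
  obtain ⟨m, hm, h1⟩ := h.exists_map_mem hA
  obtain ⟨m', hm', h1'⟩ := h.exists_map_mem hB
  obtain ⟨k, hk, h2⟩ := h.exists_bracket_mem hA hB
  have e1 : schoutenBracket δ A (schoutenBracket δ B C) = (-1 : ℤˣ) ^ b •
      schoutenBracket δ A (B * δ C) + schoutenBracket δ A (δ B * C) -
        schoutenBracket δ A (δ (B * C)) := by
    rw [schoutenBracket_apply δ hB, map_sub, map_add, map_intUnits_smul]
  have e2 := schoutenBracket_apply δ hB (schoutenBracket δ A C)
  have e3 := schoutenBracket_apply δ h2 C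
  have e4 : δ (schoutenBracket δ A B) =
      -schoutenBracket δ (δ A) B - (-1 : ℤˣ) ^ a • schoutenBracket δ A (δ B) := by
    rw [h.map_bracket hA, smul_neg, smul_smul, ← mul_pow, neg_one_mul, neg_neg, one_pow, one_smul]
    abel
  have e5 : δ (schoutenBracket δ A C) =
      -schoutenBracket δ (δ A) C - (-1 : ℤˣ) ^ a • schoutenBracket δ A (δ C) := by
    rw [h.map_bracket hA, smul_neg, smul_smul, ← mul_pow, neg_one_mul, neg_neg, one_pow, one_smul]
    abel
  rw [e1, e2, e3, e4, e5, h.map_bracket hA (B * C), h.bracket_mul a b A hA B hB,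
    h.bracket_mul a b A hA B hB, h.bracket_mul a m' A hA _ h1', h.bracket_mul m b _ h1 B hB, hk,
    pow_mul _ (a + 1) m', pow_mul _ (m + 1) b, pow_succ _ m, hm, map_add, map_intUnits_smul]
  -- The degree `m'` of δB is known only up to parity, so the exponents are exchanged to expose
  -- (-1)^m'.
  have hm'' : ((-1 : ℤˣ) ^ (a + 1)) ^ m' = ((-1) ^ m') ^ (a + 1) := by
    rw [← pow_mul, ← pow_mul, mul_comm]
  rw [hm'', hm']
  rcases neg_one_pow_eq_or ℤˣ a with ha | ha <;> rcases neg_one_pow_eq_or ℤˣ b with hb | hb <;>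
    simp [add_mul, mul_add, sub_mul, mul_sub, pow_add, pow_mul, ha, hb] <;> abel

/-- Symmetry of the bracket turns the Leibniz form of the identity into the cyclic one. -/
theorem bracket_jacobi {a b c : ℕ} {A B C : Multivector χ}
    (hA : A ∈ wedgeDeg χ a) (hB : B ∈ wedgeDeg χ b) (hC : C ∈ wedgeDeg χ c) :
    (-1 : ℤˣ) ^ (a * c) • schoutenBracket δ (schoutenBracket δ A B) C +
      (-1 : ℤˣ) ^ (b * a) • schoutenBracket δ (schoutenBracket δ B C) A +
      (-1 : ℤˣ) ^ (c * b) • schoutenBracket δ (schoutenBracket δ C A) B = 0 := by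
  obtain ⟨m, hm, h1⟩ := h.exists_bracket_mem hB hC
  obtain ⟨m', hm', h2⟩ := h.exists_bracket_mem hA hC
  have e1 := h.bracket_bracket hA hB C
  rw [h.bracket_symm h1 hA, h.bracket_symm hC hA, map_intUnits_smul, LinearMap.smul_apply,
    h.bracket_symm h2 hB, e1, pow_mul _ m, hm, pow_mul _ m', hm']
  rcases neg_one_pow_eq_or ℤˣ a with ha | ha <;> rcases neg_one_pow_eq_or ℤˣ b with hb | hb <;>
    rcases neg_one_pow_eq_or ℤˣ c with hc | hc <;>
    simp [add_mul, mul_add, pow_add, pow_mul, ha, hb, hc]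

end IsBVOperator

end BVOperator

/-! ### The codifferential is a Batalin–Vilkovisky operator. -/

section Codifferential

variable {χ : Type*} [CommRing χ] [Algebra ℝ χ] {n : ℕ} {ε : ℤˣ} {η : DForm χ n}
  {ηs : Multivector χ}

theorem one_mem_wedgeDeg_zero : (1 : Multivector χ) ∈ wedgeDeg χ 0 := by
  rw [← map_one (algebraMap χ (Multivector χ))]
  exact algebraMap_mem_wedgeDeg 1

theorem codifferential_mul_comm (ε : ℤˣ) (η : DForm χ n) (hηs : ηs ∈ wedgeDeg χ n) {a b : ℕ}
    {A B : Multivector χ} (hA : A ∈ wedgeDeg χ a) (hB : B ∈ wedgeDeg χ b) :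
    codifferential ε η ηs A * B = (-1 : ℤˣ) ^ ((a + 1) * b) • (B * codifferential ε η ηs A) := by
  cases a with
  | zero => simp [codifferential_of_mem_zero ε η hηs hA]
  | succ a =>
    rw [wedge_comm (codifferential_mem ε η hηs hA) hB, pow_mul, pow_mul _ (a + 1 + 1)]
    simp [pow_add]

/-- The bracket of the codifferential acts on forms by the double supercommutator of the operator
`formDelta`. -/
theorem rightAction_schoutenBracket (hηs : ηs ∈ wedgeDeg χ n) (hη : η.eval ηs = ((ε : ℤ) : χ))
    (h0 : ∀ X : VField χ, ηs * ExteriorAlgebra.ι χ X = 0) {a b : ℕ} {A B : Multivector χ}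
    (hA : A ∈ wedgeDeg χ a) (hB : B ∈ wedgeDeg χ b) :
    rightAction (schoutenBracket (codifferential ε η ηs) A B) =
      -((formDelta * rightAction A - (-1 : ℤˣ) ^ a • (rightAction A * formDelta)) * rightAction B -
        (-1 : ℤˣ) ^ ((a + 1) * b) • (rightAction B *
          (formDelta * rightAction A - (-1 : ℤˣ) ^ a • (rightAction A * formDelta)))) := by
  -- Second order provides some field C whose action is the double commutator. Since `rightAction C`
  -- sends ∗1 to ∗C, and Δ∗1 = ∗δ1 = 0, evaluation on ∗1 determines C.
  obtain ⟨C, -, hC⟩ := isSecondOrderOp_formDelta a A hA b B hB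
  rw [one_mul, add_comm 1 a] at hC
  rw [hC]
  have h1 : C = -schoutenBracket (codifferential ε η ηs) A B := by
    refine hodgeStar_injective hηs hη h0 ?_
    rw [← mul_one C, hodgeStar_mul, ← hC, schoutenBracket_apply _ hA,
      codifferential_mul_comm ε η hηs hA hB]
    have hD : formDelta (hodgeStar η 1) = 0 := by
      rw [← hodgeStar_codifferential hηs hη h0,
        codifferential_of_mem_zero ε η hηs one_mem_wedgeDeg_zero, map_zero]
    have hB1 : rightAction B (hodgeStar η 1) = hodgeStar η B := by rw [← hodgeStar_mul, mul_one]
    have hA1 : rightAction A (hodgeStar η 1) = hodgeStar η A := by rw [← hodgeStar_mul, mul_one]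
    rw [map_neg, map_sub, map_add, map_intUnits_smul, map_intUnits_smul,
      hodgeStar_codifferential hηs hη h0, hodgeStar_mul η A B, hodgeStar_mul η A, hodgeStar_mul η B,
      hodgeStar_codifferential hηs hη h0, hodgeStar_codifferential hηs hη h0]
    rcases neg_one_pow_eq_or ℤˣ a with ha | ha <;>
      simp [ha, sub_mul, mul_sub, add_mul, mul_add, hD, hB1, hA1] <;> abel
  rw [h1, map_neg, neg_neg]

/-- Both nontrivial properties are read off after applying the injective star: δ² = 0 from Δ² = 0,
and the Leibniz rule from the double commutator acting on ∗C. -/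
theorem isBVOperator_codifferential (hηs : ηs ∈ wedgeDeg χ n) (hη : η.eval ηs = ((ε : ℤ) : χ))
    (h0 : ∀ X : VField χ, ηs * ExteriorAlgebra.ι χ X = 0) :
    IsBVOperator (codifferential ε η ηs) where
  map_zero A hA := codifferential_of_mem_zero ε η hηs hA
  map_mem a A hA := codifferential_mem ε η hηs hA
  sq_zero A := hodgeStar_injective hηs hη h0 <| by
    rw [hodgeStar_codifferential hηs hη h0, hodgeStar_codifferential hηs hη h0, map_zero]
    exact DFunLike.congr_fun formDelta_mul_self (hodgeStar η A)
  bracket_mul a b A hA B hB C := by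
    refine hodgeStar_injective hηs hη h0 ?_
    have hS := schoutenBracket_apply (codifferential ε η ηs) hA
    have hc : codifferential ε η ηs A * (B * C) =
        (-1 : ℤˣ) ^ ((a + 1) * b) • (B * (codifferential ε η ηs A * C)) := by
      rw [← mul_assoc, codifferential_mul_comm ε η hηs hA hB, smul_mul_assoc, mul_assoc]
    rw [map_add, hodgeStar_mul _ _ C, rightAction_schoutenBracket hηs hη h0 hA hB, hS, hS, hc]
    simp only [map_intUnits_smul, map_sub, map_add, hodgeStar_codifferential hηs hη h0,
      hodgeStar_mul]
    generalize (-1 : ℤˣ) ^ ((a + 1) * b) = s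
    rcases neg_one_pow_eq_or ℤˣ a with ha | ha <;>
      rcases Int.units_eq_one_or s with rfl | rfl <;>
      simp [ha, sub_mul, mul_sub, add_mul, mul_add] <;> abel

end Codifferential

theorem intUnits_pow_cast {χ : Type*} [CommRing χ] {a : ℕ} {s : ℤˣ} (h : (-1 : ℤˣ) ^ a = s) :
    (-1 : χ) ^ a = ((s : ℤ) : χ) := by
  rw [← h]
  push_cast
  rfl

/-! ### The characterisation of the Schouten bracket by closed forms. -/

section SchoutenBracket

variable {χ : Type*} [CommRing χ] [Algebra ℝ χ]

theorem formD_of_eval {m : ℕ} {γ : DForm χ m} (hγ : extD γ = 0) :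
    formD (FormSum.of γ.eval) = 0 := by
  refine FormSum.ext_ιMulti fun k v => ?_
  cases k with
  | zero => simp
  | succ k =>
    rw [formD_ιMulti]
    by_cases hk : k = m
    · subst hk
      have : (FormSum.of γ.eval).component k = γ := by
        ext w
        exact γ.eval_ιMulti w
      rw [this, hγ]
      rfl
    · have : (FormSum.of γ.eval).component k = 0 := by
        ext w
        exact γ.eval_of_mem hk (ιMulti_mem_wedgeDeg k w)
      rw [this, map_zero]
      rfl

theorem dInner_eval {m : ℕ} (γ : DForm χ m) (B : Multivector χ) {a : ℕ} {A : Multivector χ}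
    (hA : A ∈ wedgeDeg χ a) :
    (dInner γ B a).eval A = formD (rightAction B (FormSum.of γ.eval)) A := by
  rw [wedgeDeg, ← ExteriorAlgebra.ιMulti_span_fixedDegree] at hA
  induction hA using Submodule.span_induction with
  | mem x hx =>
    obtain ⟨v, rfl⟩ := hx
    rw [DForm.eval_ιMulti]
    cases a with
    | zero => simp [dInner]
    | succ a =>
      rw [formD_ιMulti]
      rfl
  | zero => simp
  | add x y _ _ hx hy => rw [map_add, hx, hy, map_add]
  | smul f x _ hx => rw [map_smul, hx, map_smul]

theorem formDelta_apply_of_mem (φ : FormSum χ) {a : ℕ} {A : Multivector χ}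
    (hA : A ∈ wedgeDeg χ a) : formDelta φ A = (-1 : ℤˣ) ^ a • formD φ A := by
  rw [formDelta, Module.End.mul_apply, formInvolute_apply, involute_of_mem hA, map_intUnits_smul]

variable {n : ℕ} {ε : ℤˣ} {η : DForm χ n} {ηs : Multivector χ}

/-- γ({A, B}) is the value at 1 of the double commutator applied to γ. The term with Δ innermost
vanishes because γ is closed, the one with Δ outermost because exact forms vanish at 1. The two
terms with Δ in the middle remain. -/
theorem eval_schoutenBracket (hηs : ηs ∈ wedgeDeg χ n) (hη : η.eval ηs = ((ε : ℤ) : χ))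
    (h0 : ∀ X : VField χ, ηs * ExteriorAlgebra.ι χ X = 0) {a b : ℕ} {A B : Multivector χ}
    (hA : A ∈ wedgeDeg χ a) (hB : B ∈ wedgeDeg χ b) {m : ℕ} {γ : DForm χ m} (hγ : extD γ = 0) :
    γ.eval (schoutenBracket (codifferential ε η ηs) A B) =
      (dInner γ B a).eval A + (-1) ^ (a * b) * (dInner γ A b).eval B := by
  have h1 : γ.eval (schoutenBracket (codifferential ε η ηs) A B) =
      rightAction (schoutenBracket (codifferential ε η ηs) A B) (FormSum.of γ.eval) 1 := by
    rw [rightAction_apply, one_mul]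
    rfl
  have h2 : formDelta (FormSum.of γ.eval) = 0 := by
    rw [formDelta, Module.End.mul_apply, formD_of_eval hγ, map_zero]
  have h3 : ∀ φ : FormSum χ, formDelta φ 1 = 0 := fun φ => by
    rw [formDelta_apply_of_mem φ one_mem_wedgeDeg_zero, formD_one, smul_zero]
  rw [h1, rightAction_schoutenBracket hηs hη h0 hA hB, dInner_eval γ B hA, dInner_eval γ A hB]
  have h4 : ∀ φ : FormSum χ, formDelta φ A = (-1 : ℤˣ) ^ a • formD φ A := fun φ =>
    formDelta_apply_of_mem φ hA
  have h5 : ∀ φ : FormSum χ, formDelta φ B = (-1 : ℤˣ) ^ b • formD φ B := fun φ =>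
    formDelta_apply_of_mem φ hB
  rcases neg_one_pow_eq_or ℤˣ a with ha | ha <;> rcases neg_one_pow_eq_or ℤˣ b with hb | hb <;>
    simp [add_mul, pow_add, pow_mul, ha, hb, h2, h3, h4, h5, sub_mul, mul_sub,
      intUnits_pow_cast (χ := χ) ha, intUnits_pow_cast (χ := χ) hb] <;> ring

theorem mem_multivectorDeg {k : ℤ} {m : ℕ} (h : k = m) {A : Multivector χ} :
    A ∈ multivectorDeg χ k ↔ A ∈ wedgeDeg χ m := by
  subst h
  exact Iff.rfl

theorem isSchoutenBracket_codifferential (hηs : ηs ∈ wedgeDeg χ n)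
    (hη : η.eval ηs = ((ε : ℤ) : χ))
    (h0 : ∀ X : VField χ, ηs * ExteriorAlgebra.ι χ X = 0) :
    IsSchoutenBracket (schoutenBracket (codifferential ε η ηs)) := by
  intro a b A hA B hB
  have h := isBVOperator_codifferential hηs hη h0
  refine ⟨?_, fun m _ γ hγ => eval_schoutenBracket hηs hη h0 hA hB hγ⟩
  by_cases hab : a + b = 0
  · obtain ⟨rfl, rfl⟩ : a = 0 ∧ b = 0 := by omega
    rw [h.bracket_of_zero hA hB]
    exact zero_mem _
  · rw [mem_multivectorDeg (m := a + b - 1) (by omega)]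
    exact h.bracket_mem (by omega) hA hB

theorem formD_component {φ : FormSum χ} (hφ : formD φ = 0) (m : ℕ) :
    extD (φ.component m) = 0 := by
  ext v
  rw [← formD_ιMulti, hφ]
  rfl

theorem component_eval (φ : FormSum χ) {m : ℕ} {A : Multivector χ} (hA : A ∈ wedgeDeg χ m) :
    (φ.component m).eval A = φ A := by
  rw [wedgeDeg, ← ExteriorAlgebra.ιMulti_span_fixedDegree] at hA
  induction hA using Submodule.span_induction with
  | mem x hx =>
    obtain ⟨v, rfl⟩ := hx
    exact DForm.eval_ιMulti _ v
  | zero => simp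
  | add x y _ _ hx hy => rw [map_add, hx, hy, map_add]
  | smul f x _ hx => rw [map_smul, hx, map_smul]

theorem IsSchoutenBracket.unique (h : HasLocalFrames χ n) (hηs : ηs ∈ wedgeDeg χ n)
    (hη : IsUnit (η.eval ηs)) {S S' : Multivector χ →ₗ[ℝ] Multivector χ →ₗ[ℝ] Multivector χ}
    (hS : IsSchoutenBracket S) (hS' : IsSchoutenBracket S') : S = S' := by
  refine LinearMap.ext fun A => LinearMap.ext fun B => ?_
  induction A using multivector_induction with
  | add A A' hA hA' => rw [map_add, map_add, LinearMap.add_apply, LinearMap.add_apply, hA, hA']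
  | homogeneous a A hA =>
    induction B using multivector_induction with
    | add B B' hB hB' => rw [map_add, map_add, hB, hB']
    | homogeneous b B hB =>
      obtain ⟨h1, h2⟩ := hS a b A hA B hB
      obtain ⟨h1', h2'⟩ := hS' a b A hA B hB
      by_cases hab : a + b = 0
      -- For two functions no closed form is available as a test; the bracket lies in degree -1,
      -- which is zero.
      · obtain ⟨rfl, rfl⟩ : a = 0 ∧ b = 0 := by omega
        have e : S A B = 0 := h1
        have e' : S' A B = 0 := h1'
        rw [e, e']
      · rw [mem_multivectorDeg (m := a + b - 1) (by omega)] at h1 h1'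
        refine sub_eq_zero.mp (h.eq_zero_of_closed hηs hη (sub_mem h1 h1') fun φ hφ => ?_)
        have h3 := h2 (a + b - 1) (by omega) _ (formD_component hφ _)
        rw [← h2' (a + b - 1) (by omega) _ (formD_component hφ _), component_eval φ h1,
          component_eval φ h1'] at h3
        rw [map_sub, h3, sub_self]

theorem isInternal_multivectorDeg : DirectSum.IsInternal (multivectorDeg χ) := by
  have h : DirectSum.IsInternal fun a : ℕ => (wedgeDeg χ a).restrictScalars ℝ :=
    DirectSum.Decomposition.isInternal (wedgeDeg χ)
  refine DirectSum.isInternal_submodule_of_iSupIndep_of_iSup_eq_top ?_ ?_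
  -- The zero pieces in negative degrees do not affect independence; the other indices are natural
  -- numbers.
  · rw [← iSupIndep_ne_bot]
    have hn : ∀ i : {i // multivectorDeg χ i ≠ ⊥}, i.1 = (i.1.toNat : ℤ) := by
      rintro ⟨_ | _, hi⟩
      · rfl
      · exact absurd rfl hi
    have := h.submodule_iSupIndep.comp (f := fun i : {i // multivectorDeg χ i ≠ ⊥} => i.1.toNat)
      fun i j hij => Subtype.ext (by rw [hn i, hn j]; exact congrArg _ hij)
    convert this using 1
    funext i
    conv_lhs => rw [hn i]
    rfl
  · rw [eq_top_iff, ← h.submodule_iSup_eq_top]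
    exact iSup_le fun a => le_iSup (multivectorDeg χ) (a : ℤ)

end SchoutenBracket

/-! ### The Leibniz–Schouten bracket as a graded Lie bracket. -/

section GradedLie

variable {χ : Type*} [CommRing χ] [Algebra ℝ χ]

theorem eq_zero_or_mem_wedgeDeg {k : ℤ} {A : Multivector χ} (hA : A ∈ multivectorDeg χ k) :
    A = 0 ∨ ∃ m : ℕ, k = m ∧ A ∈ wedgeDeg χ m := by
  cases k with
  | ofNat m => exact Or.inr ⟨m, rfl, hA⟩
  | negSucc m => exact Or.inl hA

theorem negOnePow_sub_one_mul_sub_one (a b : ℕ) :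
    (((a : ℤ) + -1) * ((b : ℤ) + -1)).negOnePow = (-1) ^ ((a + 1) * (b + 1)) := by
  have h : (-1 : ℤˣ) ^ ((a + 1) * (b + 1)) = (((a + 1) * (b + 1) : ℕ) : ℤ).negOnePow := by
    rw [Int.negOnePow_def, zpow_natCast]
  rw [h, Int.negOnePow_eq_iff]
  exact ⟨-a - b, by push_cast; ring⟩

theorem leibnizBracket_eq_schoutenBracket (δ : Multivector χ →ₗ[ℝ] Multivector χ) {a : ℕ}
    {A : Multivector χ} (hA : A ∈ wedgeDeg χ a) (B : Multivector χ) :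
    leibnizBracket δ A B = (-1 : ℤˣ) ^ a • schoutenBracket δ A B := by
  rw [schoutenBracket_apply δ hA, leibnizBracket_apply_of_mem δ hA, add_sub_assoc, smul_add,
    smul_smul, ← mul_pow, neg_one_mul, neg_neg, one_pow, one_smul]

theorem schoutenBracket_eq_leibnizBracket (δ : Multivector χ →ₗ[ℝ] Multivector χ) {a : ℕ}
    {A : Multivector χ} (hA : A ∈ wedgeDeg χ a) (B : Multivector χ) :
    schoutenBracket δ A B = (-1 : ℤˣ) ^ a • leibnizBracket δ A B := by
  rw [leibnizBracket_eq_schoutenBracket δ hA, smul_smul, ← mul_pow, neg_one_mul, neg_neg, one_pow,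
    one_smul]

theorem IsBVOperator.leibnizBracket_leibnizBracket {δ : Multivector χ →ₗ[ℝ] Multivector χ}
    (h : IsBVOperator δ) {a b : ℕ} {A B : Multivector χ} (hA : A ∈ wedgeDeg χ a)
    (hB : B ∈ wedgeDeg χ b) (C : Multivector χ) :
    leibnizBracket δ (leibnizBracket δ A B) C =
      (-1 : ℤˣ) ^ (b + 1) • schoutenBracket δ (schoutenBracket δ A B) C := by
  obtain ⟨m, hm, h1⟩ := h.exists_bracket_mem hA hB
  rw [leibnizBracket_eq_schoutenBracket δ hA, map_intUnits_smul, LinearMap.smul_apply,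
    leibnizBracket_eq_schoutenBracket δ h1, hm, smul_smul, add_assoc, pow_add _ a, ← mul_assoc,
    ← mul_pow, neg_one_mul, neg_neg, one_pow, one_mul]

theorem IsBVOperator.isGradedLieAlgebra {δ : Multivector χ →ₗ[ℝ] Multivector χ}
    (h : IsBVOperator δ) : IsGradedLieAlgebra (multivectorDeg χ) (-1) (leibnizBracket δ) where
  internal := isInternal_multivectorDeg
  degree a b A hA B hB := by
    obtain rfl | ⟨a, rfl, hA⟩ := eq_zero_or_mem_wedgeDeg hA
    · simp
    obtain rfl | ⟨b, rfl, hB⟩ := eq_zero_or_mem_wedgeDeg hB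
    · simp
    rw [leibnizBracket_eq_schoutenBracket δ hA]
    by_cases hab : a + b = 0
    · obtain ⟨rfl, rfl⟩ : a = 0 ∧ b = 0 := by omega
      rw [h.bracket_of_zero hA hB, smul_zero]
      exact zero_mem _
    · rw [mem_multivectorDeg (m := a + b - 1) (by omega)]
      have h1 := h.bracket_mem (m := a + b - 1) (by omega) hA hB
      rcases neg_one_pow_eq_or ℤˣ a with ha | ha <;> simpa [ha] using h1
  anticomm a b A hA B hB := by
    obtain rfl | ⟨a, rfl, hA⟩ := eq_zero_or_mem_wedgeDeg hA
    · simp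
    obtain rfl | ⟨b, rfl, hB⟩ := eq_zero_or_mem_wedgeDeg hB
    · simp
    rw [negOnePow_sub_one_mul_sub_one, leibnizBracket_eq_schoutenBracket δ hA,
      leibnizBracket_eq_schoutenBracket δ hB, h.bracket_symm hA hB]
    rcases neg_one_pow_eq_or ℤˣ a with ha | ha <;> rcases neg_one_pow_eq_or ℤˣ b with hb | hb <;>
      simp [add_mul, mul_add, pow_add, pow_mul, ha, hb]
  jacobi a b c A hA B hB C hC := by
    obtain rfl | ⟨a, rfl, hA⟩ := eq_zero_or_mem_wedgeDeg hA
    · simp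
    obtain rfl | ⟨b, rfl, hB⟩ := eq_zero_or_mem_wedgeDeg hB
    · simp
    obtain rfl | ⟨c, rfl, hC⟩ := eq_zero_or_mem_wedgeDeg hC
    · simp
    rw [negOnePow_sub_one_mul_sub_one, negOnePow_sub_one_mul_sub_one,
      negOnePow_sub_one_mul_sub_one, h.leibnizBracket_leibnizBracket hA hB,
      h.leibnizBracket_leibnizBracket hB hC, h.leibnizBracket_leibnizBracket hC hA]
    -- The signs of the two cyclic identities differ by the common factor (-1)^(a+b+c), which is
    -- invariant under the cyclic permutations.
    have h1 := congrArg (fun D => (-1 : ℤˣ) ^ (a + b + c) • D) (h.bracket_jacobi hA hB hC)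
    simp only [smul_zero, smul_add, smul_smul] at h1 ⊢
    have e : ∀ i j k : ℕ, (-1 : ℤˣ) ^ ((i + 1) * (k + 1)) * (-1) ^ (j + 1) =
        (-1) ^ (i + j + k) * (-1) ^ (i * k) := fun i j k => by
      rw [← pow_add, ← pow_add, show (i + 1) * (k + 1) + (j + 1) = i + j + k + i * k + 2 by ring,
        pow_add _ _ 2]
      simp
    rw [← h1, e, e, e, show b + c + a = a + b + c by ring, show c + a + b = a + b + c by ring]

theorem HasLocalFrames.isGradedLieAlgebra_and_schoutenBracket {n : ℕ} (h : HasLocalFrames χ n)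
    (ε : ℤˣ) (η : DForm χ n) (ηs : Multivector χ) (hηs : ηs ∈ wedgeDeg χ n)
    (hη : η.eval ηs = ((ε : ℤ) : χ)) :
    IsGradedLieAlgebra (multivectorDeg χ) (-1) (leibnizBracket (codifferential ε η ηs)) ∧
    ∃ S : Multivector χ →ₗ[ℝ] Multivector χ →ₗ[ℝ] Multivector χ,
      IsSchoutenBracket S ∧ (∀ S', IsSchoutenBracket S' → S' = S) ∧
      (∀ a : ℕ, ∀ A ∈ wedgeDeg χ a, ∀ B,
        S A B = (-1 : ℤˣ) ^ a • leibnizBracket (codifferential ε η ηs) A B) ∧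
      (∀ a b : ℕ, ∀ A ∈ wedgeDeg χ a, ∀ B ∈ wedgeDeg χ b,
        S A B = (-1 : ℤˣ) ^ (a * b) • S B A) ∧
      (∀ a b c : ℕ, ∀ A ∈ wedgeDeg χ a, ∀ B ∈ wedgeDeg χ b, ∀ C ∈ wedgeDeg χ c,
        (-1 : ℤˣ) ^ (a * c) • S (S A B) C + (-1 : ℤˣ) ^ (b * a) • S (S B C) A +
          (-1 : ℤˣ) ^ (c * b) • S (S C A) B = 0) := by
  have hu : IsUnit (η.eval ηs) := by
    rw [hη]
    exact ε.isUnit.map (Int.castRingHom χ)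
  have h0 : ∀ X : VField χ, ηs * ExteriorAlgebra.ι χ X = 0 := fun X =>
    h.eq_zero_of_mem_succ hηs hu (mul_mem_wedgeDeg hηs (ι_mem_wedgeDeg_one X))
  have hδ := isBVOperator_codifferential hηs hη h0
  have hS := isSchoutenBracket_codifferential hηs hη h0
  exact ⟨hδ.isGradedLieAlgebra, schoutenBracket (codifferential ε η ηs), hS,
    fun S' hS' => hS'.unique h hηs hu hS,
    fun a A hA B => schoutenBracket_eq_leibnizBracket _ hA B,
    fun a b A hA B hB => hδ.bracket_symm hA hB,
    fun a b c A hA B hB C hC => hδ.bracket_jacobi hA hB hC⟩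

end GradedLie

/-! ### Hadamard's lemma. -/

section Hadamard

open MeasureTheory Set

theorem deriv_smoothTransition_of_notMem {s : ℝ} (hs : s ∉ Icc (0 : ℝ) 1) :
    deriv Real.smoothTransition s = 0 := by
  have h : s < 0 ∨ 1 < s := by
    by_contra! h
    exact hs h
  rcases h with h | h
  · have : Real.smoothTransition =ᶠ[nhds s] fun _ => 0 := by
      filter_upwards [Iio_mem_nhds h] with t ht
      exact Real.smoothTransition.zero_of_nonpos ht.le
    rw [this.deriv_eq, deriv_const]
  · have : Real.smoothTransition =ᶠ[nhds s] fun _ => 1 := by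
      filter_upwards [Ioi_mem_nhds h] with t ht
      exact Real.smoothTransition.one_of_one_le ht.le
    rw [this.deriv_eq, deriv_const]

/-- Hadamard's lemma on a convex open set. -/
theorem ContDiffOn.exists_eq_add_apply_sub {E : Type*} [NormedAddCommGroup E] [NormedSpace ℝ E]
    {U : Set E} (hU : IsOpen U) (hc : Convex ℝ U) {F : E → ℝ} (hF : ContDiffOn ℝ ∞ F U) {q : E}
    (hq : q ∈ U) :
    ∃ G : E → E →L[ℝ] ℝ, ContDiffOn ℝ ∞ G U ∧ ∀ y ∈ U, F y = F q + G y (y - q) := by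
  let θ := Real.smoothTransition
  -- The segment from q to y is parametrised by a smooth step θ rather than by s itself. The
  -- integrand is then smooth on the whole line and supported in [0, 1].
  let g : E → ℝ → E →L[ℝ] ℝ := fun y s => deriv θ s • fderiv ℝ F (q + θ s • (y - q))
  have hθ : ContDiff ℝ ∞ θ := Real.smoothTransition.contDiff
  have hθ' : ContDiff ℝ ∞ (deriv θ) := ((contDiff_infty_iff_deriv).mp hθ).2
  have hmem : ∀ y ∈ U, ∀ s, q + θ s • (y - q) ∈ U := fun y hy s =>
    hc.add_smul_sub_mem hq hy ⟨Real.smoothTransition.nonneg s, Real.smoothTransition.le_one s⟩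
  have hF' : ContDiffOn ℝ ∞ (fderiv ℝ F) U := hF.fderiv_of_isOpen hU (by simp)
  have hg : ContDiffOn ℝ ∞ (Function.HasUncurry.uncurry g) (U ×ˢ (univ : Set ℝ)) := by
    have h1 : ContDiffOn ℝ ∞ (fun p : E × ℝ => fderiv ℝ F (q + θ p.2 • (p.1 - q)))
        (U ×ˢ (univ : Set ℝ)) := by
      refine hF'.comp (ContDiff.contDiffOn ?_) fun p hp => hmem p.1 hp.1 p.2
      exact contDiff_const.add ((hθ.comp contDiff_snd).smul (contDiff_fst.sub contDiff_const))
    exact ((hθ'.comp contDiff_snd).contDiffOn).smul h1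
  have hk : ∀ y s, y ∈ U → s ∉ Icc (0 : ℝ) 1 → g y s = 0 := fun y s _ hs => by
    simp only [g, θ, deriv_smoothTransition_of_notMem hs, zero_smul]
  refine ⟨fun y => ∫ s, g y s, ?_, fun y hy => ?_⟩
  -- The integral over s is the convolution with the constant 1 evaluated at 0, so its smoothness in
  -- y is that of a convolution depending on a parameter.
  · have h1 := contDiffOn_convolution_right_with_param (μ := (volume : Measure ℝ)) (n := ⊤)
      (f := fun _ : ℝ => (1 : ℝ)) (ContinuousLinearMap.lsmul ℝ ℝ) hU isCompact_Icc hk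
      (locallyIntegrable_const 1) hg
    have h2 : ContDiffOn ℝ ∞ (fun y : E => (y, (0 : ℝ))) U :=
      (contDiff_id.prodMk contDiff_const).contDiffOn
    refine (h1.comp h2 fun y hy => ⟨hy, mem_univ _⟩).congr fun y hy => ?_
    simp only [Function.comp_apply, convolution_def, ContinuousLinearMap.lsmul_apply, one_smul]
    exact (integral_sub_left_eq_self (fun s => g y s) volume 0).symm
  · have hcont : Continuous (g y) := by
      have : ContinuousOn (fun s : ℝ => Function.HasUncurry.uncurry g (y, s)) univ :=
        hg.continuousOn.comp (by fun_prop) fun s _ => ⟨hy, mem_univ s⟩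
      exact continuousOn_univ.mp this
    have hint : Integrable (g y) := hcont.integrable_of_hasCompactSupport
      (HasCompactSupport.intro isCompact_Icc fun s hs => hk y s hy hs)
    -- Any interval containing [0, 1] in its interior would do; θ is 0 at -1 and 1 at 2.
    rw [ContinuousLinearMap.integral_apply hint,
      ← intervalIntegral.integral_eq_integral_of_support_subset (a := -1) (b := 2)]
    · rw [intervalIntegral.integral_eq_sub_of_hasDerivAt (f := fun s => F (q + θ s • (y - q)))]
      · have e1 : θ 2 = 1 := Real.smoothTransition.one_of_one_le (by norm_num)
        have e2 : θ (-1) = 0 := Real.smoothTransition.zero_of_nonpos (by norm_num)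
        simp [e1, e2]
      · intro s _
        have h1 : HasDerivAt θ (deriv θ s) s :=
          (hθ.differentiable (by simp) s).hasDerivAt
        have h2 : HasDerivAt (fun s => q + θ s • (y - q)) (deriv θ s • (y - q)) s :=
          (h1.smul_const (y - q)).const_add q
        have h3 : HasFDerivAt F (fderiv ℝ F (q + θ s • (y - q))) (q + θ s • (y - q)) :=
          ((hF.contDiffAt (hU.mem_nhds (hmem y hy s))).differentiableAt (by simp)).hasFDerivAt
        have h4 := h3.comp_hasDerivAt s h2
        rw [map_smul] at h4
        exact h4
      · exact ((ContinuousLinearMap.apply ℝ ℝ (y - q)).continuous.comp hcont).intervalIntegrable _ _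
    · intro s hs
      by_contra h
      refine hs ?_
      change g y s (y - q) = 0
      rw [hk y s hy fun h' => h ⟨by linarith [h'.1], by linarith [h'.2]⟩]
      rfl

theorem eq_fderiv_of_eq_add_apply_sub {E : Type*} [NormedAddCommGroup E] [NormedSpace ℝ E]
    {U : Set E} (hU : IsOpen U) {F : E → ℝ} {q : E} (hq : q ∈ U) {G : E → E →L[ℝ] ℝ}
    (hG : ContDiffOn ℝ ∞ G U) (h : ∀ y ∈ U, F y = F q + G y (y - q)) : fderiv ℝ F q = G q := by
  have h1 : HasFDerivAt G (fderiv ℝ G q) q :=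
    ((hG.contDiffAt (hU.mem_nhds hq)).differentiableAt (by simp)).hasFDerivAt
  have h2 := (h1.clm_apply ((hasFDerivAt_id q).sub_const q)).const_add (F q)
  have h3 : F =ᶠ[nhds q] fun y => F q + G y (id y - q) := by
    filter_upwards [hU.mem_nhds hq] with y hy
    exact h y hy
  rw [(h2.congr_of_eventuallyEq h3).fderiv]
  ext v
  simp

end Hadamard

/-! ### Local frames on a smooth manifold. -/

section ManifoldFrames

open Set

variable {n : ℕ} {M : Type*} [TopologicalSpace M] [ChartedSpace (EuclideanSpace ℝ (Fin n)) M]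

/-- Locality of derivations: r equals 1 wherever s is nonzero, and the Leibniz rule for s r = s at q
leaves s(q) X(r)(q) = 0. -/
theorem derivation_apply_eq_zero {s r : C^∞⟮𝓡 n, M; ℝ⟯} (h : s * r = s) {q : M} (hs : s q ≠ 0)
    (hr : r q = 1) (X : VField C^∞⟮𝓡 n, M; ℝ⟯) : X r q = 0 := by
  have h1 := congrArg (fun f => X f q) h
  simp only [Derivation.leibniz] at h1
  change s q * X r q + r q * X s q = X s q at h1
  rw [hr, one_mul, add_eq_right] at h1
  exact (mul_eq_zero.mp h1).resolve_left hs

variable [IsManifold (𝓡 n) ∞ M]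

theorem contDiffOn_comp_extChartAt_symm (p : M) (f : C^∞⟮𝓡 n, M; ℝ⟯) :
    ContDiffOn ℝ ∞ (f ∘ (extChartAt (𝓡 n) p).symm) (extChartAt (𝓡 n) p).target :=
  contMDiffOn_iff_contDiffOn.mp
    (f.contMDiff.comp_contMDiffOn (contMDiffOn_extChartAt_symm (n := ∞) p))

/-- The derivative of a function in the direction of a constant vector in a chart. -/
def chartDeriv (p : M) (v : EuclideanSpace ℝ (Fin n)) (f : C^∞⟮𝓡 n, M; ℝ⟯) (m : M) : ℝ :=
  fderiv ℝ (f ∘ (extChartAt (𝓡 n) p).symm) (extChartAt (𝓡 n) p m) v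

theorem contMDiffOn_chartDeriv (p : M) (v : EuclideanSpace ℝ (Fin n)) (f : C^∞⟮𝓡 n, M; ℝ⟯) :
    ContMDiffOn (𝓡 n) 𝓘(ℝ, ℝ) ∞ (chartDeriv p v f)
      (chartAt (EuclideanSpace ℝ (Fin n)) p).source := by
  have h1 : ContDiffOn ℝ ∞ (fun y => fderiv ℝ (f ∘ (extChartAt (𝓡 n) p).symm) y v)
      (extChartAt (𝓡 n) p).target :=
    ((contDiffOn_comp_extChartAt_symm p f).fderiv_of_isOpen (isOpen_extChartAt_target p)
      (by simp)).clm_apply contDiffOn_const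
  refine (contMDiffOn_iff_contDiffOn.mpr h1).comp (contMDiffOn_extChartAt (n := ∞)) fun m hm => ?_
  rw [← extChartAt_source (𝓡 n)] at hm
  exact (extChartAt (𝓡 n) p).map_source hm

theorem differentiableAt_comp_extChartAt_symm {p m : M}
    (hm : m ∈ (chartAt (EuclideanSpace ℝ (Fin n)) p).source) (f : C^∞⟮𝓡 n, M; ℝ⟯) :
    DifferentiableAt ℝ (f ∘ (extChartAt (𝓡 n) p).symm) (extChartAt (𝓡 n) p m) := by
  rw [← extChartAt_source (𝓡 n)] at hm
  exact ((contDiffOn_comp_extChartAt_symm p f).contDiffAt ((isOpen_extChartAt_target p).mem_nhds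
    ((extChartAt (𝓡 n) p).map_source hm))).differentiableAt (by simp)

variable [T2Space M]

/-- The product of a bump function and a constant vector field in a chart. -/
def bumpVField {p : M} (σ : SmoothBumpFunction (𝓡 n) p) (v : EuclideanSpace ℝ (Fin n)) :
    VField C^∞⟮𝓡 n, M; ℝ⟯ :=
  Derivation.mk'
    { toFun := fun f => ⟨fun m => σ m • chartDeriv p v f m,
        σ.contMDiff_smul (contMDiffOn_chartDeriv p v f)⟩
      map_add' := fun f g => by
        ext m
        by_cases hm : m ∈ (chartAt (EuclideanSpace ℝ (Fin n)) p).source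
        · have h := fderiv_add (differentiableAt_comp_extChartAt_symm hm f)
            (differentiableAt_comp_extChartAt_symm hm g)
          have h' := congrArg (fun T => σ m • T v) h
          exact h'.trans (mul_add _ _ _)
        · have : σ m = 0 := Function.notMem_support.mp fun h => hm (σ.support_subset_source h)
          change σ m * chartDeriv p v (f + g) m =
            σ m * chartDeriv p v f m + σ m * chartDeriv p v g m
          simp [this]
      map_smul' := fun c f => by
        ext m
        by_cases hm : m ∈ (chartAt (EuclideanSpace ℝ (Fin n)) p).source
        · have h := fderiv_const_smul (differentiableAt_comp_extChartAt_symm hm f) c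
          have h' := congrArg (fun T => σ m • T v) h
          exact h'.trans (smul_comm (σ m) c (chartDeriv p v f m))
        · have : σ m = 0 := Function.notMem_support.mp fun h => hm (σ.support_subset_source h)
          change σ m * chartDeriv p v (c • f) m = c * (σ m * chartDeriv p v f m)
          simp [this] }
    fun f g => by
      ext m
      by_cases hm : m ∈ (chartAt (EuclideanSpace ℝ (Fin n)) p).source
      · have h := fderiv_mul (differentiableAt_comp_extChartAt_symm hm f)
          (differentiableAt_comp_extChartAt_symm hm g)
        have h' := congrArg (fun T => σ m * T v) h
        have hs : (extChartAt (𝓡 n) p).symm (extChartAt (𝓡 n) p m) = m :=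
          (extChartAt (𝓡 n) p).left_inv (by rwa [extChartAt_source])
        refine h'.trans ?_
        simp only [Function.comp_apply, hs]
        change σ m * (f m * chartDeriv p v g m + g m * chartDeriv p v f m) =
          f m * (σ m * chartDeriv p v g m) + g m * (σ m * chartDeriv p v f m)
        ring
      · have : σ m = 0 := Function.notMem_support.mp fun h => hm (σ.support_subset_source h)
        change σ m * chartDeriv p v (f * g) m =
          f m * (σ m * chartDeriv p v g m) + g m * (σ m * chartDeriv p v f m)
        simp [this]

/-- The frame function is a bump function σ at p. Hadamard's lemma in a chart shows that on the
support of σ every derivation is the combination of the coordinate derivatives with coefficients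
X(x_k). The x_k are cut-off coordinates and the E_k are σ times the coordinate derivatives. -/
theorem exists_isFrameFunction (p : M) :
    ∃ g : C^∞⟮𝓡 n, M; ℝ⟯, IsFrameFunction n g ∧ g p = 1 := by
  let φ := extChartAt (𝓡 n) p
  -- Hadamard's lemma needs a convex domain, hence the restriction to a ball in the chart.
  obtain ⟨R, hR, hball⟩ := Metric.isOpen_iff.mp (isOpen_extChartAt_target (I := 𝓡 n) p) (φ p)
    (mem_extChartAt_target p)
  let V : Set M := φ.source ∩ φ ⁻¹' Metric.ball (φ p) R
  have hVo : IsOpen V := isOpen_extChartAt_preimage' p Metric.isOpen_ball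
  have hpV : p ∈ V := ⟨mem_extChartAt_source p, Metric.mem_ball_self hR⟩
  -- Two nested bumps: ρ is supported in the ball and extends local functions by zero, and ρ = 1 on
  -- the support of σ, so there the cut-off is invisible.
  obtain ⟨ρ, -, hρ⟩ := (SmoothBumpFunction.nhds_basis_tsupport (I := 𝓡 n) p).mem_iff.mp
    (hVo.mem_nhds hpV)
  obtain ⟨σ, -, hσ⟩ := (SmoothBumpFunction.nhds_basis_tsupport (I := 𝓡 n) p).mem_iff.mp
    ρ.eventuallyEq_one
  have hcut : ∀ h : M → ℝ, ContMDiffOn (𝓡 n) 𝓘(ℝ, ℝ) ∞ h V →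
      ContMDiff (𝓡 n) 𝓘(ℝ, ℝ) ∞ fun m => ρ m • h m := fun h hh =>
    contMDiff_of_tsupport fun m hm => by
      have hm' : m ∈ V := hρ (tsupport_smul_subset_left _ _ hm)
      exact ρ.contMDiffAt.smul ((hh m hm').contMDiffAt (hVo.mem_nhds hm'))
  have hφ : ContMDiffOn (𝓡 n) 𝓘(ℝ, EuclideanSpace ℝ (Fin n)) ∞ φ V :=
    (contMDiffOn_extChartAt (n := ∞)).mono fun m hm => by
      rw [← extChartAt_source (𝓡 n)]
      exact hm.1
  let e : Fin n → EuclideanSpace ℝ (Fin n) := fun k => EuclideanSpace.single k 1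
  let r : C^∞⟮𝓡 n, M; ℝ⟯ := ⟨ρ, ρ.contMDiff⟩
  let s : C^∞⟮𝓡 n, M; ℝ⟯ := ⟨σ, σ.contMDiff⟩
  let x : Fin n → C^∞⟮𝓡 n, M; ℝ⟯ := fun k => ⟨fun m => ρ m • φ m k, hcut _
    ((EuclideanSpace.proj k : EuclideanSpace ℝ (Fin n) →L[ℝ] ℝ).contMDiff.comp_contMDiffOn hφ)⟩
  have hsum : ∀ (g : Fin n → C^∞⟮𝓡 n, M; ℝ⟯) (m : M), (∑ k, g k) m = ∑ k, g k m := fun g m =>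
    map_sum (ContMDiffMap.evalRingHom m) g _
  have hρ1 : ∀ q, σ q ≠ 0 → ρ q = 1 := fun q hq => hσ (subset_tsupport _ hq)
  have hsr : s * r = s := by
    ext q
    change σ q * ρ q = σ q
    by_cases hq : σ q = 0
    · rw [hq, zero_mul]
    · rw [hρ1 q hq, mul_one]
  have key : ∀ (X : VField C^∞⟮𝓡 n, M; ℝ⟯) (f : C^∞⟮𝓡 n, M; ℝ⟯) (q : M), σ q ≠ 0 →
      X f q = ∑ k, X (x k) q * chartDeriv p (e k) f q := by
    intro X f q hq
    have hqV : q ∈ V := hρ (subset_tsupport _ (by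
      rw [Function.mem_support, hρ1 q hq]
      exact one_ne_zero))
    obtain ⟨G, hG, hGF⟩ :=
      ((contDiffOn_comp_extChartAt_symm p f).mono hball).exists_eq_add_apply_sub
      Metric.isOpen_ball (convex_ball _ _) hqV.2
    have hGq := eq_fderiv_of_eq_add_apply_sub Metric.isOpen_ball hqV.2 hG hGF
    let a : Fin n → C^∞⟮𝓡 n, M; ℝ⟯ := fun k => ⟨fun m => ρ m • G (φ m) (e k), hcut _
      ((contMDiffOn_iff_contDiffOn.mpr (hG.clm_apply contDiffOn_const)).comp hφ fun m hm => hm.2)⟩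
    -- Hadamard's expansion multiplied by ρ²: one factor makes the coefficients globally smooth and
    -- the other the coordinates. Applying X at q, where ρ = 1 and X(ρ) = 0, then yields the
    -- expansion of X f.
    have hid : r * r * (f - algebraMap ℝ _ (f q)) =
        ∑ k, a k * (x k - algebraMap ℝ _ (φ q k) * r) := by
      ext m
      rw [hsum]
      change ρ m * ρ m * (f m - f q) =
        ∑ k, ρ m * G (φ m) (e k) * (ρ m * φ m k - φ q k * ρ m)
      by_cases hm : ρ m = 0
      · simp [hm]
      · have hmV : m ∈ V := hρ (subset_tsupport _ hm)
        have h1 := hGF (φ m) hmV.2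
        have h2 : φ.symm (φ m) = m := φ.left_inv hmV.1
        have h3 : φ.symm (φ q) = q := φ.left_inv hqV.1
        have h4 : φ m - φ q = ∑ k, (φ m k - φ q k) • e k := by
          ext i
          simp [e, Pi.single_apply]
        rw [Function.comp_apply, Function.comp_apply, h2, h3] at h1
        rw [h1, add_sub_cancel_left]
        rw [h4]
        rw [map_sum, Finset.mul_sum]
        refine Finset.sum_congr rfl fun k _ => ?_
        rw [map_smul, smul_eq_mul]
        ring
    have hr : r q = 1 := hρ1 q hq
    have hXr : X r q = 0 := derivation_apply_eq_zero hsr hq hr X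
    have hX : ∀ u v : C^∞⟮𝓡 n, M; ℝ⟯, X (u * v) q = u q * X v q + v q * X u q := fun u v => by
      rw [Derivation.leibniz]
      rfl
    have hXs : ∀ (u v : C^∞⟮𝓡 n, M; ℝ⟯), X (u - v) q = X u q - X v q := fun u v => by
      rw [map_sub]
      rfl
    have hXc : ∀ c : ℝ, X (algebraMap ℝ _ c) q = 0 := fun c => by
      rw [Derivation.map_algebraMap]
      rfl
    have hrr : (r * r) q = 1 := by
      change r q * r q = 1
      rw [hr, one_mul]
    have hf : (f - algebraMap ℝ _ (f q)) q = 0 := sub_self (f q)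
    have hx : ∀ k, (x k - algebraMap ℝ _ (φ q k) * r) q = 0 := fun k => by
      change ρ q * φ q k - φ q k * ρ q = 0
      ring
    have ha : ∀ k, a k q = chartDeriv p (e k) f q := fun k => by
      change ρ q * G (φ q) (e k) = _
      rw [hρ1 q hq, one_mul, ← hGq]
      rfl
    have h1 := congrArg (fun f => X f q) hid
    simp only [map_sum, hsum, hX, hXs, hXc, hrr, hf, hx, hXr, ha, mul_zero, zero_mul, add_zero,
      sub_zero, one_mul] at h1
    rw [h1]
    exact Finset.sum_congr rfl fun k _ => mul_comm _ _
  refine ⟨s, ⟨x, fun k => bumpVField σ (e k), fun X => ?_⟩, σ.eq_one⟩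
  ext f q
  have h1 : (∑ k, X (x k) • bumpVField σ (e k)) f q =
      ∑ k, X (x k) q * (σ q * chartDeriv p (e k) f q) := by
    rw [← Derivation.coeFnAddMonoidHom_apply, map_sum, Finset.sum_apply, hsum]
    rfl
  rw [h1]
  change σ q * X f q = _
  by_cases hq : σ q = 0
  · simp [hq]
  · rw [key X f q hq, Finset.mul_sum]
    exact Finset.sum_congr rfl fun k _ => mul_left_comm _ _ _

theorem hasLocalFrames_contMDiffMap : HasLocalFrames C^∞⟮𝓡 n, M; ℝ⟯ n := by
  intro f hf
  ext p
  obtain ⟨g, hg, hgp⟩ := exists_isFrameFunction (n := n) p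
  obtain ⟨N, hN⟩ := hf g hg
  have h : g p ^ N * f p = 0 := by
    have := congrArg (fun f => f p) hN
    simpa using this
  simpa [hgp] using h

end ManifoldFrames

end

/-- The Leibniz-Schouten algebra of a manifold with a volume element is a `(-1)`-graded Lie algebra;
equivalently, the Schouten bracket has the corresponding symmetry and Jacobi property. -/
theorem mainTheorem4 {n : ℕ} {M : Type*} [TopologicalSpace M]
    [ChartedSpace (EuclideanSpace ℝ (Fin n)) M] [IsManifold (𝓡 n) ∞ M]
    [T2Space M] [SigmaCompactSpace M]
    (ε : ℤˣ) (η : DForm C^∞⟮𝓡 n, M; ℝ⟯ n) (ηs : Multivector C^∞⟮𝓡 n, M; ℝ⟯)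
    (hηs : ηs ∈ wedgeDeg C^∞⟮𝓡 n, M; ℝ⟯ n)
    (hη : η.eval ηs = ((ε : ℤ) : C^∞⟮𝓡 n, M; ℝ⟯)) :
    IsGradedLieAlgebra (multivectorDeg C^∞⟮𝓡 n, M; ℝ⟯) (-1)
      (leibnizBracket (codifferential ε η ηs)) ∧
    ∃ S : Multivector C^∞⟮𝓡 n, M; ℝ⟯ →ₗ[ℝ] Multivector C^∞⟮𝓡 n, M; ℝ⟯ →ₗ[ℝ]
        Multivector C^∞⟮𝓡 n, M; ℝ⟯,
      IsSchoutenBracket S ∧ (∀ S', IsSchoutenBracket S' → S' = S) ∧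
      (∀ a : ℕ, ∀ A ∈ wedgeDeg C^∞⟮𝓡 n, M; ℝ⟯ a, ∀ B,
        S A B = (-1 : ℤˣ) ^ a • leibnizBracket (codifferential ε η ηs) A B) ∧
      (∀ a b : ℕ, ∀ A ∈ wedgeDeg C^∞⟮𝓡 n, M; ℝ⟯ a, ∀ B ∈ wedgeDeg C^∞⟮𝓡 n, M; ℝ⟯ b,
        S A B = (-1 : ℤˣ) ^ (a * b) • S B A) ∧
      (∀ a b c : ℕ, ∀ A ∈ wedgeDeg C^∞⟮𝓡 n, M; ℝ⟯ a, ∀ B ∈ wedgeDeg C^∞⟮𝓡 n, M; ℝ⟯ b,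
        ∀ C ∈ wedgeDeg C^∞⟮𝓡 n, M; ℝ⟯ c,
        (-1 : ℤˣ) ^ (a * c) • S (S A B) C + (-1 : ℤˣ) ^ (b * a) • S (S B C) A +
          (-1 : ℤˣ) ^ (c * b) • S (S C A) B = 0) :=
  hasLocalFrames_contMDiffMap.isGradedLieAlgebra_and_schoutenBracket ε η ηs hηs hη
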